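/- Let $A\ge 1$ (an absolute constant measuring all implicit "up to $O(1)$" factors). For $R\ge 2$ let $\mathbb I_{R^{-1/3}}$ be the partition of $[0,1]$ into the intervals $I=[c,c+R^{-1/3}]$, $c=kR^{-1/3}<1$, $k=0,1,2,\dots$ (the last interval may stick out of $[0,1]$). For such an $I$, a $(d_1,d_2,d_3)$-box associated with $I$ is a set $S\subset\mathbb R^3$ for which there is $a\in\mathbb R^3$ with $a+A^{-1}B\subset S\subset a+AB$, where $$B=\{x\in\mathbb R^3: |x_1+2cx_2+3c^2x_3|\le d_1,\ |x_2+3cx_3|\le d_2,\ |x_3|\le d_3\}$$ (the axes of $B$ are, up to $O(1)$, the tangent, normal and binormal of the twisted cubic $(t,t^2,t^3)$ at $t=c$). A family of sets has bounded overlap if no point lies in more than $A$ of its members. Let $\mathbb T=\bigcup_I\mathbb T(I)$ be a finite collection of separated $(R^{2/3},R^{2/3},R)$-Vinogradov tubes: for each $I\in\mathbb I_{R^{-1/3}}$, $\mathbb T(I)$ consists of $(R^{2/3},R^{2/3},R)$-boxes associated with $I$, contained in $[-AR,AR]^3$ and having bounded overlap. Let $N_1\le N$ be non-negative integers and assume: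 (S1) For each $I$ there is a cover of $[-AR,AR]^3$, with bounded overlap, by $(R^{2/3},R,R)$-boxes $S_I$ associated with $I$, such that each $T\in\mathbb T(I)$ is contained in some $S_I$, and each $S_I$ contains at most $N$ tubes $T\in\mathbb T(I)$. (S2) For each $I$ there is a cover of $[-AR,AR]^3$, with bounded overlap, by $(R^{2/3},R^{5/6},R)$-boxes $B_I$ associated with $I$, such that each $T\in\mathbb T(I)$ is contained in some $B_I$, and each $B_I$ contains at most $N_1$ tubes $T\in\mathbb T(I)$. For real $r\ge1$ let $\mathcal Q_r$ be a finite collection of cubes (in any orientation) with pairwise disjoint interiors and side lengths in $[A^{-1}R^{2/3},AR^{2/3}]$, each of which intersects at least $r$ tubes of $\mathbb T$ (tubes are counted together with their interval $I$). Then there are constants $C$ and $\kappa$, depending only on $A$, such that for every $\varepsilon>0$ there is $C(\varepsilon)>0$, depending only on $\varepsilon$ and $A$, such that for all $R\ge2$ and all $\mathbb T,N,N_1,r,\mathcal Q_r$ as above with $$r\ge C(\varepsilon)R^{\varepsilon}N_1R^{1/6}$$ we have $$|\mathcal Q_r|\le C(\log R)^{\kappa}\,\frac{|\mathbb T|\,N_1R^{1/3}}{r^2}.$$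 -/

import Mathlib

noncomputable section

/-- Euclidean three-space, with coordinates `x 0, x 1, x 2`. -/
abbrev E3 : Type := EuclideanSpace ℝ (Fin 3)

/-- The box centred at `a`, oriented along the Frenet frame of the twisted cubic at `(c, c², c³)`,
with dimensions `(d₁, d₂, d₃)` along the tangent, normal and binormal axes (in the usual
parallelepiped form: the slabs are normal to `(1, 2c, 3c²)`, `(0, 1, 3c)`, `(0, 0, 1)`; the long
edge has the direction `(3c², -3c, 1)` of the binormal). -/
def vinogradovBox (c d₁ d₂ d₃ : ℝ) (a : E3) : Set E3 :=
  {x | |(x 0 - a 0) + 2 * c * (x 1 - a 1) + 3 * c ^ 2 * (x 2 - a 2)| ≤ d₁ ∧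
       |(x 1 - a 1) + 3 * c * (x 2 - a 2)| ≤ d₂ ∧
       |x 2 - a 2| ≤ d₃}

/-- `S` is, up to the factor `A`, a `(d₁, d₂, d₃)`-box with the orientation associated with `c`:
it lies between the `A⁻¹`-dilate and the `A`-dilate of such a box. -/
def IsVinogradovBox (A c d₁ d₂ d₃ : ℝ) (S : Set E3) : Prop :=
  ∃ a : E3, vinogradovBox c (A⁻¹ * d₁) (A⁻¹ * d₂) (A⁻¹ * d₃) a ⊆ S ∧
    S ⊆ vinogradovBox c (A * d₁) (A * d₂) (A * d₃) a

/-- The cube `[-L, L]³`. -/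
def coordCube (L : ℝ) : Set E3 := {x | ∀ i, |x i| ≤ L}

/-- No point lies in more than `A` members of the family. -/
def BoundedOverlap (A : ℝ) (F : Set (Set E3)) : Prop :=
  ∀ x : E3, {S | S ∈ F ∧ x ∈ S}.Finite ∧ ({S | S ∈ F ∧ x ∈ S}.ncard : ℝ) ≤ A

/-- Left endpoint of the `k`-th interval `I = [c, c + R^{-1/3}]` in the partition of `[0, 1]` into
intervals of length `R^{-1/3}`. The intervals of the partition are those with `leftEnd R k < 1`. -/
def leftEnd (R : ℝ) (k : ℕ) : ℝ := k * R ^ (-(1 / 3) : ℝ)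

/-- The tubes of the family that are associated with the `k`-th interval. A tube is recorded as
a pair consisting of the index of its interval and the tube itself. -/
def tubesOf (𝕋 : Finset (ℕ × Set E3)) (k : ℕ) : Set (Set E3) := {T | (k, T) ∈ 𝕋}

/-- `𝕋` is a collection of separated `(R^{2/3}, R^{2/3}, R)`-Vinogradov tubes in `[-AR, AR]³`:
the parallel tubes associated with each interval have bounded overlap. -/
def IsSeparatedTubeFamily (A R : ℝ) (𝕋 : Finset (ℕ × Set E3)) : Prop :=
  (∀ p ∈ 𝕋, leftEnd R p.1 < 1 ∧
    IsVinogradovBox A (leftEnd R p.1) (R ^ (2 / 3 : ℝ)) (R ^ (2 / 3 : ℝ)) R p.2 ∧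
    p.2 ⊆ coordCube (A * R)) ∧
  ∀ k, BoundedOverlap A (tubesOf 𝕋 k)

/-- `F` is a boundedly overlapping cover of `[-AR, AR]³` by `(d₁, d₂, d₃)`-boxes with the
orientation associated with `c`. -/
def IsBoxCover (A R c d₁ d₂ d₃ : ℝ) (F : Set (Set E3)) : Prop :=
  (∀ S ∈ F, IsVinogradovBox A c d₁ d₂ d₃ S) ∧ BoundedOverlap A F ∧ coordCube (A * R) ⊆ ⋃₀ F

/-- For each interval `I`, the region is covered by `(d₁, d₂, d₃)`-boxes oriented along `I`; each
tube of `𝕋(I)` sits inside one of these boxes, and each box contains at most `N` tubes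
of `𝕋(I)`. -/
def SpacingCondition (A R d₁ d₂ d₃ : ℝ) (𝕋 : Finset (ℕ × Set E3)) (N : ℕ) : Prop :=
  ∀ k : ℕ, leftEnd R k < 1 → ∃ F : Set (Set E3),
    IsBoxCover A R (leftEnd R k) d₁ d₂ d₃ F ∧
    (∀ T ∈ tubesOf 𝕋 k, ∃ S ∈ F, T ⊆ S) ∧
    ∀ S ∈ F, {T | T ∈ tubesOf 𝕋 k ∧ T ⊆ S}.ncard ≤ N

/-- `q` is a closed cube of side length `s`, in any orientation. -/
def IsCubeOfSide (s : ℝ) (q : Set E3) : Prop :=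
  ∃ (e : OrthonormalBasis (Fin 3) ℝ E3) (a : E3),
    q = {x | ∀ i, |inner ℝ (e i) (x - a)| ≤ s / 2}

/-- `q` intersects at least `r` tubes of `𝕋`. -/
def IsRich (𝕋 : Finset (ℕ × Set E3)) (r : ℝ) (q : Set E3) : Prop :=
  r ≤ ({p | p ∈ 𝕋 ∧ (p.2 ∩ q).Nonempty}.ncard : ℝ)

/-- `Q` is a collection of non-overlapping `r`-rich cubes of side length `∼ R^{2/3}`. -/
def IsRichCubeFamily (A R : ℝ) (𝕋 : Finset (ℕ × Set E3)) (r : ℝ) (Q : Finset (Set E3)) : Prop :=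
  (∀ q ∈ Q, (∃ s : ℝ, A⁻¹ * R ^ (2 / 3 : ℝ) ≤ s ∧ s ≤ A * R ^ (2 / 3 : ℝ) ∧ IsCubeOfSide s q) ∧
    IsRich 𝕋 r q) ∧
  (Q : Set (Set E3)).PairwiseDisjoint interior

end

noncomputable section

open MeasureTheory

/-! The proof is a high-low argument with Gaussians in place of cutoffs. Divide lengths by `R^{2/3}`
and put `d = R^{-1/3}`. The cubes become unit-sized, the tubes become `(1, 1, 1/d)`-boxes with
directions `c = k * d`, and at most `P = O(N₁)` parallel tubes have their centres in a given `(1,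
d^{-1/2}, 1/d)`-plank. Compare the Gaussian of each tube with its average in the normal direction at
scale `d^{-1/2}`. The averaged (low) part sees only plank counts: each of the `O(1/d)` directions
contributes `O(d^{1/2} P)` at any point, in total `O(P d^{-1/2}) = O(N₁ R^{1/6})`. The lower bound
on `r` makes this less than half of what a rich point receives, so the difference (the high part) is
of size at least a constant times `r` there.

Summed over the rich points, the high part is in frequency space a pairing of the exponential sum of
the points with those of the tubes. A direction `c` lives on a slab of thickness `d`, and its high
part is governed by the normal frequency `m = ξ₁ - 2cξ₀`. The binormal frequency `ξ₂ - 3cξ₁ + 3c²ξ₀`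
has `c`-derivative `-3m`. Hence the sum over the slabs, weighted by `|m|`, is essentially the
variation of a bounded function of a quadratic polynomial, and so is bounded
(`sum_abs_normal_mul_exp_le`).

The squared high-pass multiplier is at most `|m| * W` with `W` a dyadic sum of Gaussians
(`sq_one_sub_exp_le`). A weighted AM-GM inequality gives the weight `|m|` to the points and `W` to
the tubes. Separation of the points bounds the first term by `O(|X|)`. The inverse transform of `W`
consists of Gaussians on planks of width at most about `d^{-1/2}`, so the second term is `O(J² d P
|𝕋|)`, where `J` is of order `log R` (`sum_highFrequency_le`). Balancing the two gives `r² d |X| ≲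
J² P |𝕋|` (`card_rich_points_le`), which is the claim after rescaling (`card_rich_cubes_le`). -/

/-! ### Frenet coordinates and Fourier transforms of sheared Gaussians. -/

/-- The coordinates of a vector `y` in the dual Frenet frame of the twisted cubic at `c`. -/
def frenetCoord (c : ℝ) (y : Fin 3 → ℝ) : Fin 3 → ℝ :=
  ![y 0 + 2 * c * y 1 + 3 * c ^ 2 * y 2, y 1 + 3 * c * y 2, y 2]

/-- The shear dual to `frenetCoord c`. -/
def dualShear (c : ℝ) : (Fin 3 → ℝ) →ₗ[ℝ] (Fin 3 → ℝ) :=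
  Matrix.toLin' !![1, 0, 0; -2 * c, 1, 0; 3 * c ^ 2, -3 * c, 1]

lemma dualShear_zero (c : ℝ) (ξ : Fin 3 → ℝ) : dualShear c ξ 0 = ξ 0 := by
  simp [dualShear, Matrix.toLin'_apply, Matrix.mulVec, dotProduct, Fin.sum_univ_three]

lemma dualShear_one (c : ℝ) (ξ : Fin 3 → ℝ) : dualShear c ξ 1 = ξ 1 - 2 * c * ξ 0 := by
  simp [dualShear, Matrix.toLin'_apply, Matrix.mulVec, dotProduct, Fin.sum_univ_three]; ring

lemma dualShear_two (c : ℝ) (ξ : Fin 3 → ℝ) :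
    dualShear c ξ 2 = ξ 2 - 3 * c * ξ 1 + 3 * c ^ 2 * ξ 0 := by
  simp [dualShear, Matrix.toLin'_apply, Matrix.mulVec, dotProduct, Fin.sum_univ_three]; ring

/-- The two coordinate changes are inverse transposes of each other, so shearing the frequency
diagonalises the quadratic form without altering the phase. -/
lemma dualShear_dotProduct (c : ℝ) (ξ y : Fin 3 → ℝ) :
    ∑ i, dualShear c ξ i * frenetCoord c y i = ∑ i, ξ i * y i := by
  simp only [Fin.sum_univ_three, dualShear_zero, dualShear_one, dualShear_two, frenetCoord,
    Matrix.cons_val_zero, Matrix.cons_val_one, Matrix.cons_val]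
  ring

lemma measurePreserving_dualShear (c : ℝ) :
    MeasurePreserving (dualShear c) (volume : Measure (Fin 3 → ℝ)) volume := by
  have hdet : LinearMap.det (dualShear c) = 1 := by
    simp [dualShear, LinearMap.det_toLin', Matrix.det_fin_three]
  refine ⟨(LinearMap.continuous_of_finiteDimensional _).measurable, ?_⟩
  rw [Real.map_linearMap_volume_pi_eq_smul_volume_pi (by rw [hdet]; norm_num), hdet]
  simp

lemma measurableEmbedding_dualShear (c : ℝ) : MeasurableEmbedding (dualShear c) := by
  have hinj : Function.Injective (dualShear c) := by
    intro x y h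
    ext i
    have h0 := congrFun h 0
    have h1 := congrFun h 1
    have h2 := congrFun h 2
    rw [dualShear_zero, dualShear_zero] at h0
    rw [dualShear_one, dualShear_one, h0] at h1
    have h1' : x 1 = y 1 := by linarith
    rw [dualShear_two, dualShear_two, h0, h1'] at h2
    fin_cases i
    · exact h0
    · exact h1'
    · simp only [Fin.reduceFinMk]; linarith
  exact (LinearMap.continuous_of_finiteDimensional (dualShear c)).measurableEmbedding hinj

/-- The quadratic form with coefficients `b` in the frame dual to the Frenet frame at `c`. -/
def shearedForm (c : ℝ) (b : Fin 3 → ℝ) (ξ : Fin 3 → ℝ) : ℝ := ∑ i, b i * dualShear c ξ i ^ 2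

lemma cos_mul_exp_eq_re (b z η : Fin 3 → ℝ) :
    Real.cos (2 * Real.pi * ∑ i, η i * z i) * Real.exp (-Real.pi * ∑ i, b i * η i ^ 2) =
      (Complex.exp (-∑ i, ((Real.pi * b i : ℝ) : ℂ) * (η i : ℂ) ^ 2 +
        ∑ i, (2 * Real.pi * z i * Complex.I : ℂ) * (η i : ℂ))).re := by
  have e1 : (-∑ i, ((Real.pi * b i : ℝ) : ℂ) * (η i : ℂ) ^ 2 +
      ∑ i, (2 * Real.pi * z i * Complex.I : ℂ) * (η i : ℂ)) =
      ((-Real.pi * ∑ i, b i * η i ^ 2 : ℝ) : ℂ) +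
        ((2 * Real.pi * ∑ i, η i * z i : ℝ) : ℂ) * Complex.I := by
    push_cast
    simp only [Fin.sum_univ_three]
    ring
  rw [e1, Complex.exp_re, Complex.add_re, Complex.add_im, Complex.ofReal_re, Complex.ofReal_im,
    Complex.re_ofReal_mul, Complex.im_ofReal_mul, Complex.I_re, Complex.I_im]
  ring_nf

lemma integrable_cos_mul_gaussian (c : ℝ) (b : Fin 3 → ℝ) (hb : ∀ i, 0 < b i) (y : Fin 3 → ℝ) :
    Integrable fun ξ : Fin 3 → ℝ => Real.cos (2 * Real.pi * ∑ i, ξ i * y i) *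
      Real.exp (-Real.pi * shearedForm c b ξ) := by
  have h := (GaussianFourier.integrable_cexp_neg_sum_mul_add (ι := Fin 3)
    (b := fun i => ((Real.pi * b i : ℝ) : ℂ))
    (fun i => by simpa using mul_pos Real.pi_pos (hb i))
    (fun i => (2 * Real.pi * frenetCoord c y i * Complex.I : ℂ))).re
  have h2 := ((measurePreserving_dualShear c).integrable_comp_emb
    (measurableEmbedding_dualShear c)).2 h
  refine h2.congr (Filter.Eventually.of_forall fun ξ => ?_)
  simp only [Function.comp]
  rw [← dualShear_dotProduct c ξ y, shearedForm, cos_mul_exp_eq_re]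
  rfl

/-- The shear has determinant one; after it the integral is a product of one-dimensional Gaussian
transforms. -/
lemma integral_cos_mul_gaussian (c : ℝ) (b : Fin 3 → ℝ) (hb : ∀ i, 0 < b i) (y : Fin 3 → ℝ) :
    ∫ ξ : Fin 3 → ℝ, Real.cos (2 * Real.pi * ∑ i, ξ i * y i) *
      Real.exp (-Real.pi * shearedForm c b ξ) =
      (∏ i, (Real.sqrt (b i))⁻¹) * Real.exp (-Real.pi * ∑ i, frenetCoord c y i ^ 2 / b i) := by
  have hre : ∀ i, 0 < (((Real.pi * b i : ℝ) : ℂ)).re := fun i => by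
    simpa using mul_pos Real.pi_pos (hb i)
  have h := GaussianFourier.integral_cexp_neg_sum_mul_add (ι := Fin 3)
    (b := fun i => ((Real.pi * b i : ℝ) : ℂ)) hre
    (fun i => (2 * Real.pi * frenetCoord c y i * Complex.I : ℂ))
  have hi := GaussianFourier.integrable_cexp_neg_sum_mul_add (ι := Fin 3)
    (b := fun i => ((Real.pi * b i : ℝ) : ℂ)) hre
    (fun i => (2 * Real.pi * frenetCoord c y i * Complex.I : ℂ))
  have e := (measurePreserving_dualShear c).integral_comp (measurableEmbedding_dualShear c)
    (fun η : Fin 3 → ℝ => Real.cos (2 * Real.pi * ∑ i, η i * frenetCoord c y i) *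
      Real.exp (-Real.pi * ∑ i, b i * η i ^ 2))
  simp only [dualShear_dotProduct] at e
  simp only [shearedForm]
  rw [e]
  simp only [cos_mul_exp_eq_re]
  have h3 := integral_re hi
  simp only [RCLike.re_eq_complex_re] at h3
  rw [h3, h]
  have e2 : (∏ i, ((Real.pi : ℂ) / ((Real.pi * b i : ℝ) : ℂ)) ^ (1 / 2 : ℂ) *
      Complex.exp ((2 * Real.pi * frenetCoord c y i * Complex.I : ℂ) ^ 2 /
        (4 * ((Real.pi * b i : ℝ) : ℂ)))) =
      ((∏ i, (Real.sqrt (b i))⁻¹ * Real.exp (-Real.pi * (frenetCoord c y i ^ 2 / b i)) : ℝ) : ℂ) := by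
    rw [Complex.ofReal_prod]
    refine Finset.prod_congr rfl fun i _ => ?_
    have hbi := (hb i).ne'
    have hpi := Real.pi_ne_zero
    have hb' : (b i : ℂ) ≠ 0 := by exact_mod_cast hbi
    have hpi' : (Real.pi : ℂ) ≠ 0 := by exact_mod_cast hpi
    have e3 : ((Real.pi : ℂ) / ((Real.pi * b i : ℝ) : ℂ)) ^ (1 / 2 : ℂ) =
        (((Real.sqrt (b i))⁻¹ : ℝ) : ℂ) := by
      rw [← Complex.ofReal_div, show (1 / 2 : ℂ) = ((1 / 2 : ℝ) : ℂ) by push_cast; rfl,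
        ← Complex.ofReal_cpow (div_nonneg Real.pi_pos.le (mul_pos Real.pi_pos (hb i)).le),
        ← Real.sqrt_eq_rpow, ← Real.sqrt_inv]
      congr 2
      field_simp
    rw [e3]
    push_cast
    congr 2
    field_simp
    rw [Complex.I_sq]
    ring
  rw [e2, Complex.ofReal_re, Finset.prod_mul_distrib, ← Real.exp_sum, Finset.mul_sum]

/-! ### Gaussian sums over separated points. -/

lemma one_add_sq_le_exp (x : ℝ) : 1 + x ^ 2 ≤ Real.exp (Real.pi / 2 * x ^ 2) := by
  have h := Real.add_one_le_exp (Real.pi / 2 * x ^ 2)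
  nlinarith [Real.pi_gt_three, sq_nonneg x]

lemma summable_inv_one_add_int_sq : Summable fun m : ℤ => 3 / (1 + (m : ℝ) ^ 2) := by
  have h := (Real.summable_one_div_int_pow (p := 2)).2 (by norm_num)
  refine (h.mul_left 3).of_norm_bounded_eventually ?_
  have : ∀ᶠ m : ℤ in Filter.cofinite, m ≠ 0 := Filter.eventually_cofinite_ne 0
  filter_upwards [this] with m hm
  have hm' : (0 : ℝ) < (m : ℝ) ^ 2 := by positivity
  rw [Real.norm_of_nonneg (by positivity), ← mul_div_assoc, mul_one]
  exact div_le_div_of_nonneg_left (by norm_num) hm' (by linarith)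

/-- The total mass of a product weight on `ℤ³` that dominates Gaussians. -/
def latticeMass : ℝ := (∑' m : ℤ, 3 / (1 + (m : ℝ) ^ 2)) ^ 3

lemma latticeMass_nonneg : 0 ≤ latticeMass :=
  pow_nonneg (tsum_nonneg fun m => by positivity) 3

/-- Quadratic decay is all that is kept, since it is summable over `ℤ`; passing to the floor costs
`m² ≤ 2t² + 2`. -/
lemma exp_neg_mul_sq_le_floor {η : ℝ} (h0 : 0 < η) (h1 : η ≤ 1) (t : ℝ) :
    Real.exp (-Real.pi * (η * t ^ 2)) ≤ η⁻¹ * (3 / (1 + (⌊t⌋ : ℝ) ^ 2)) := by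
  have hfl := Int.floor_le t
  have hlt := Int.lt_floor_add_one t
  set m : ℝ := (⌊t⌋ : ℝ)
  have hm : m ^ 2 ≤ 2 * t ^ 2 + 2 := by nlinarith [sq_nonneg (m - 2 * t), sq_nonneg (t - m)]
  have he := Real.add_one_le_exp (Real.pi * (η * t ^ 2))
  have h3 : η * (1 + m ^ 2) ≤ 3 * Real.exp (Real.pi * (η * t ^ 2)) := by
    have : 0 ≤ η * t ^ 2 := by positivity
    nlinarith [Real.pi_gt_three]
  rw [neg_mul, Real.exp_neg, inv_mul_eq_div, div_div, inv_eq_one_div,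
    div_le_div_iff₀ (Real.exp_pos _) (by positivity)]
  linarith

/-- Points with at most `P` of them in each cell of the unit lattice have bounded Gaussian sums. -/
lemma sum_gaussian_le {ι : Type*} (s : Finset ι) (φ : ι → Fin 3 → ℝ) {P η : ℝ} (hP0 : 0 ≤ P)
    (h0 : 0 < η) (h1 : η ≤ 1)
    (hP : ∀ m : Fin 3 → ℤ, ((s.filter fun i => (fun j => ⌊φ i j⌋) = m).card : ℝ) ≤ P) :
    ∑ i ∈ s, Real.exp (-Real.pi * ∑ j, η * φ i j ^ 2) ≤ P * (η⁻¹ ^ 3 * latticeMass) := by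
  classical
  set h : ℤ → ℝ := fun m => 3 / (1 + (m : ℝ) ^ 2) with hh
  have hpos : ∀ m, 0 ≤ h m := fun m => by simp only [hh]; positivity
  set S : Finset ℤ := (s ×ˢ Finset.univ).image fun p : ι × Fin 3 => ⌊φ p.1 p.2⌋
  have hS : ∀ i ∈ s, (fun j => ⌊φ i j⌋) ∈ Fintype.piFinset fun _ : Fin 3 => S := by
    intro i hi
    rw [Fintype.mem_piFinset]
    exact fun j => Finset.mem_image.2 ⟨(i, j), by simp [hi], rfl⟩
  have hterm : ∀ i ∈ s, Real.exp (-Real.pi * ∑ j, η * φ i j ^ 2) ≤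
      η⁻¹ ^ 3 * ∏ j, h ⌊φ i j⌋ := by
    intro i _
    rw [Finset.mul_sum, Real.exp_sum]
    calc ∏ j, Real.exp (-Real.pi * (η * φ i j ^ 2)) ≤ ∏ j : Fin 3, η⁻¹ * h ⌊φ i j⌋ :=
          Finset.prod_le_prod (fun _ _ => (Real.exp_pos _).le)
            fun j _ => exp_neg_mul_sq_le_floor h0 h1 _
      _ = _ := by rw [Finset.prod_mul_distrib]; simp
  have hη : 0 ≤ η⁻¹ ^ 3 := by positivity
  calc ∑ i ∈ s, Real.exp (-Real.pi * ∑ j, η * φ i j ^ 2)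
      ≤ ∑ i ∈ s, η⁻¹ ^ 3 * ∏ j, h ⌊φ i j⌋ := Finset.sum_le_sum hterm
    _ = η⁻¹ ^ 3 * ∑ m ∈ Fintype.piFinset fun _ : Fin 3 => S,
          ∑ i ∈ s with (fun j => ⌊φ i j⌋) = m, ∏ j, h ⌊φ i j⌋ := by
        rw [← Finset.mul_sum, Finset.sum_fiberwise_of_maps_to hS]
    _ ≤ η⁻¹ ^ 3 * ∑ m ∈ Fintype.piFinset fun _ : Fin 3 => S, P * ∏ j, h (m j) := by
        refine mul_le_mul_of_nonneg_left (Finset.sum_le_sum fun m _ => ?_) hη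
        calc ∑ i ∈ s with (fun j => ⌊φ i j⌋) = m, ∏ j, h ⌊φ i j⌋
            = ∑ i ∈ s with (fun j => ⌊φ i j⌋) = m, ∏ j, h (m j) := by
              refine Finset.sum_congr rfl fun i hi => ?_
              rw [← (Finset.mem_filter.1 hi).2]
          _ ≤ P * ∏ j, h (m j) := by
              rw [Finset.sum_const, nsmul_eq_mul]
              exact mul_le_mul_of_nonneg_right (hP m) (Finset.prod_nonneg fun j _ => hpos _)
    _ = η⁻¹ ^ 3 * (P * (∑ m ∈ S, h m) ^ 3) := by
        rw [← Finset.mul_sum, ← Finset.prod_univ_sum (fun _ : Fin 3 => S) (fun _ m => h m)]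
        simp
    _ ≤ η⁻¹ ^ 3 * (P * latticeMass) := by
        refine mul_le_mul_of_nonneg_left (mul_le_mul_of_nonneg_left ?_ hP0) hη
        exact pow_le_pow_left₀ (Finset.sum_nonneg fun m _ => hpos m)
          (summable_inv_one_add_int_sq.sum_le_tsum S fun m _ => hpos m) 3
    _ = _ := by ring

/-! ### Variation of the arctangent of a quadratic polynomial. -/

/-- Each monotone stretch telescopes. The `min` covers a turning point beyond the end of the range.
-/
lemma sum_abs_sub_eq_of_unimodal (s : ℕ → ℝ) (n m : ℕ) (h1 : ∀ k < n, k < m → s (k + 1) ≤ s k)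
    (h2 : ∀ k < n, m ≤ k → s k ≤ s (k + 1)) :
    ∑ k ∈ Finset.range n, |s (k + 1) - s k| = s 0 + s n - 2 * s (min n m) := by
  induction n with
  | zero => simp; ring
  | succ n ih =>
    rw [Finset.sum_range_succ, ih (fun k hk => h1 k (by omega)) (fun k hk => h2 k (by omega))]
    rcases lt_or_ge n m with h | h
    · rw [abs_of_nonpos (by linarith [h1 n (by omega) h]), min_eq_left h.le, min_eq_left h]
      ring
    · rw [abs_of_nonneg (by linarith [h2 n (by omega) h]), min_eq_right h,
        min_eq_right (by omega : m ≤ n + 1)]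
      ring

/-- Increments of a convex quadratic are nondecreasing in `k`, so the sequence falls and then rises.
The arctangent keeps this shape and confines the values to `(-π/2, π/2)`, whatever the coefficients.
-/
lemma sum_abs_arctan_quadratic_le_of_nonneg {α : ℝ} (hα : 0 ≤ α) (β γ : ℝ) (n : ℕ) (q : ℕ → ℝ)
    (hq : ∀ k : ℕ, q k = α * k ^ 2 + β * k + γ) :
    ∑ k ∈ Finset.range n, |Real.arctan (q (k + 1)) - Real.arctan (q k)| ≤ 2 * Real.pi := by
  classical
  have hΔ : ∀ k : ℕ, q (k + 1) - q k = α * (2 * k + 1) + β := fun k => by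
    rw [hq, hq]; push_cast; ring
  obtain ⟨m, hm1, hm2⟩ : ∃ m, (∀ k < n, k < m → q (k + 1) ≤ q k) ∧
      ∀ k < n, m ≤ k → q k ≤ q (k + 1) := by
    by_cases h : ∃ k, q k ≤ q (k + 1)
    · refine ⟨Nat.find h, fun k _ hk => (not_le.1 (Nat.find_min h hk)).le, fun k _ hk => ?_⟩
      have h1 := Nat.find_spec h
      have h2 := hΔ (Nat.find h)
      have h3 := hΔ k
      have h4 : ((Nat.find h : ℕ) : ℝ) ≤ k := by exact_mod_cast hk
      nlinarith
    · push Not at h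
      exact ⟨n, fun k _ _ => (h k).le, fun k hk hk' => by omega⟩
  rw [sum_abs_sub_eq_of_unimodal (fun k => Real.arctan (q k)) n m
    (fun k hk hk' => Real.arctan_strictMono.monotone (hm1 k hk hk'))
    (fun k hk hk' => Real.arctan_strictMono.monotone (hm2 k hk hk'))]
  linarith [Real.arctan_lt_pi_div_two (q 0), Real.arctan_lt_pi_div_two (q n),
    Real.neg_pi_div_two_lt_arctan (q (min n m))]

/-- The arctangent of a quadratic polynomial has variation at most `2π`. -/
lemma sum_abs_arctan_quadratic_le (α β γ : ℝ) (n : ℕ) (q : ℕ → ℝ)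
    (hq : ∀ k : ℕ, q k = α * k ^ 2 + β * k + γ) :
    ∑ k ∈ Finset.range n, |Real.arctan (q (k + 1)) - Real.arctan (q k)| ≤ 2 * Real.pi := by
  rcases le_total 0 α with h | h
  · exact sum_abs_arctan_quadratic_le_of_nonneg h β γ n q hq
  · have := sum_abs_arctan_quadratic_le_of_nonneg (neg_nonneg.2 h) (-β) (-γ) n (fun k => -q k)
      fun k => by rw [hq]; ring
    refine le_trans (le_of_eq (Finset.sum_congr rfl fun k _ => ?_)) this
    rw [Real.arctan_neg, Real.arctan_neg, ← abs_neg]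
    congr 1
    ring

lemma sub_le_mul_arctan_sub {x y D : ℝ} (hx : -D ≤ x) (hy : y ≤ D) (hxy : x ≤ y) :
    y - x ≤ (1 + D ^ 2) * (Real.arctan y - Real.arctan x) := by
  have h := (convex_Icc (-D) D).mul_sub_le_image_sub_of_le_deriv (f := Real.arctan)
    (C := (1 + D ^ 2)⁻¹) Real.continuous_arctan.continuousOn
    Real.differentiable_arctan.differentiableOn (fun z hz => by
      rw [interior_Icc] at hz
      rw [(Real.hasDerivAt_arctan z).deriv, ← one_div (1 + D ^ 2)]
      refine one_div_le_one_div_of_le (by positivity) ?_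
      nlinarith [hz.1, hz.2]) x ⟨hx, hxy.trans hy⟩ y ⟨hx.trans hxy, hy⟩ hxy
  rwa [inv_mul_le_iff₀ (by positivity)] at h

/-- The mean value theorem on `[-D, D]` with `D = |x| + M`. The polynomial factors are harmless:
they will be absorbed by Gaussian decay. -/
lemma abs_sub_le_mul_abs_arctan_sub {x y M : ℝ} (h : |y - x| ≤ M) :
    |y - x| ≤ 2 * (1 + x ^ 2) * (1 + M ^ 2) * |Real.arctan y - Real.arctan x| := by
  have hM : 0 ≤ M := (abs_nonneg _).trans h
  have hD : 1 + (|x| + M) ^ 2 ≤ 2 * (1 + x ^ 2) * (1 + M ^ 2) := by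
    nlinarith [sq_nonneg (|x| - M), sq_abs x, mul_nonneg (sq_nonneg x) (sq_nonneg M)]
  obtain ⟨h1, h2⟩ := abs_le.1 h
  have hx1 := neg_abs_le x
  have hx2 := le_abs_self x
  refine le_trans ?_ (mul_le_mul_of_nonneg_right hD (abs_nonneg _))
  rcases le_total x y with hxy | hxy
  · rw [abs_of_nonneg (sub_nonneg.2 hxy),
      abs_of_nonneg (sub_nonneg.2 (Real.arctan_strictMono.monotone hxy))]
    exact sub_le_mul_arctan_sub (by linarith) (by linarith) hxy
  · rw [abs_of_nonpos (sub_nonpos.2 hxy),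
      abs_of_nonpos (sub_nonpos.2 (Real.arctan_strictMono.monotone hxy)), neg_sub, neg_sub]
    exact sub_le_mul_arctan_sub (by linarith) (by linarith) hxy

/-! ### Overlap of the dual slabs, weighted by the normal frequency. -/

lemma shearedForm_eq (c : ℝ) (b ξ : Fin 3 → ℝ) :
    shearedForm c b ξ = b 0 * ξ 0 ^ 2 + b 1 * (ξ 1 - 2 * c * ξ 0) ^ 2 +
      b 2 * (ξ 2 - 3 * c * ξ 1 + 3 * c ^ 2 * ξ 0) ^ 2 := by
  rw [shearedForm, Fin.sum_univ_three, dualShear_zero, dualShear_one, dualShear_two]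

/-- The coefficients of the form dual to the `(1, √(1 + t), d⁻¹)`-box. -/
def boxCoeff (d t : ℝ) : Fin 3 → ℝ := ![1, 1 + t, (d ^ 2)⁻¹]

lemma shearedForm_boxCoeff (c d t : ℝ) (ξ : Fin 3 → ℝ) :
    shearedForm c (boxCoeff d t) ξ =
      shearedForm c (boxCoeff d 0) ξ + t * (ξ 1 - 2 * c * ξ 0) ^ 2 := by
  simp only [shearedForm_eq, boxCoeff, Matrix.cons_val_zero, Matrix.cons_val_one, Matrix.cons_val]
  ring

/-- Here `x`, `μ`, `q` are the tangential, normal and rescaled binormal frequencies for one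
direction, and `q'` is the binormal one for the next. The increment `q' - q` controls `μ` up to `d *
x`, and half of the Gaussian pays for replacing it by an increment of the arctangent. -/
lemma abs_mul_exp_neg_le {x μ q q' d : ℝ} (hq' : q' = q + (-3 * μ + 3 * d * x)) (h0 : 0 < d)
    (h1 : d ≤ 1) :
    |μ| * Real.exp (-Real.pi * (x ^ 2 + μ ^ 2 + q ^ 2)) ≤
      (12 * |Real.arctan q' - Real.arctan q| + d) *
        Real.exp (-Real.pi / 2 * (x ^ 2 + μ ^ 2 + q ^ 2)) := by
  have hM : |q' - q| ≤ 3 * |μ| + 3 * |x| := by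
    rw [hq', add_sub_cancel_left]
    refine (abs_add_le _ _).trans ?_
    rw [abs_mul, abs_mul, abs_mul, abs_neg, abs_of_pos h0]
    norm_num
    nlinarith [abs_nonneg x]
  have hA := abs_sub_le_mul_abs_arctan_sub hM
  set V := |Real.arctan q' - Real.arctan q| with hV
  have hV0 : 0 ≤ V := abs_nonneg _
  have hμ : 3 * |μ| ≤ |q' - q| + 3 * d * |x| := by
    have : |3 * μ| ≤ |q' - q| + |3 * d * x| := by
      rw [show 3 * μ = -(q' - q) + 3 * d * x by rw [hq']; ring]
      refine (abs_add_le _ _).trans ?_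
      rw [abs_neg]
    rw [abs_mul, abs_mul, abs_mul, abs_of_pos h0] at this
    norm_num at this
    exact this
  have hMs : 1 + (3 * |μ| + 3 * |x|) ^ 2 ≤ 18 * (1 + (x ^ 2 + μ ^ 2)) := by
    nlinarith [sq_nonneg (|μ| - |x|), sq_abs μ, sq_abs x]
  have hx : |x| ≤ 1 + (x ^ 2 + μ ^ 2) := by nlinarith [sq_nonneg (|x| - 1), sq_abs x, sq_nonneg μ]
  have hsum : |μ| ≤ (12 * V + d) * ((1 + q ^ 2) * (1 + (x ^ 2 + μ ^ 2))) := by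
    have e1 : 2 * (1 + q ^ 2) * (1 + (3 * |μ| + 3 * |x|) ^ 2) * V ≤
        2 * (1 + q ^ 2) * (18 * (1 + (x ^ 2 + μ ^ 2))) * V := by gcongr
    have e2 : d * |x| ≤ d * ((1 + q ^ 2) * (1 + (x ^ 2 + μ ^ 2))) := by
      gcongr
      nlinarith [sq_nonneg q, sq_nonneg x, sq_nonneg μ, mul_nonneg (sq_nonneg q)
        (add_nonneg (sq_nonneg x) (sq_nonneg μ))]
    nlinarith
  have hexp : (1 + q ^ 2) * (1 + (x ^ 2 + μ ^ 2)) ≤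
      Real.exp (Real.pi / 2 * (x ^ 2 + μ ^ 2 + q ^ 2)) := by
    have hs : 1 + (x ^ 2 + μ ^ 2) ≤ Real.exp (Real.pi / 2 * (x ^ 2 + μ ^ 2)) := by
      have h := Real.add_one_le_exp (Real.pi / 2 * (x ^ 2 + μ ^ 2))
      nlinarith [Real.pi_gt_three, sq_nonneg x, sq_nonneg μ]
    rw [show Real.pi / 2 * (x ^ 2 + μ ^ 2 + q ^ 2) =
      Real.pi / 2 * q ^ 2 + Real.pi / 2 * (x ^ 2 + μ ^ 2) by ring, Real.exp_add]
    exact mul_le_mul (one_add_sq_le_exp q) hs (by positivity) (Real.exp_pos _).le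
  calc |μ| * Real.exp (-Real.pi * (x ^ 2 + μ ^ 2 + q ^ 2))
      ≤ (12 * V + d) * Real.exp (Real.pi / 2 * (x ^ 2 + μ ^ 2 + q ^ 2)) *
          Real.exp (-Real.pi * (x ^ 2 + μ ^ 2 + q ^ 2)) := by
        refine mul_le_mul_of_nonneg_right (hsum.trans ?_) (Real.exp_pos _).le
        exact mul_le_mul_of_nonneg_left hexp (by positivity)
    _ = _ := by
        rw [mul_assoc, ← Real.exp_add]
        congr 2
        ring

/-- The slabs dual to the tubes overlap boundedly when weighted by the frequency in the normal
direction. -/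
lemma sum_abs_normal_mul_exp_le {d : ℝ} (h0 : 0 < d) (h1 : d ≤ 1) {n : ℕ} (hn : n * d ≤ 2)
    (hk : ∀ k < n, k * d ≤ 1) (ξ : Fin 3 → ℝ) :
    ∑ k ∈ Finset.range n, |ξ 1 - 2 * (k * d) * ξ 0| *
        Real.exp (-Real.pi * shearedForm (k * d) (boxCoeff d 0) ξ) ≤
      98 * Real.exp (-Real.pi * shearedForm 0 (fun _ => 1 / 100) ξ) := by
  set q : ℕ → ℝ := fun k => (ξ 2 - 3 * (k * d) * ξ 1 + 3 * (k * d) ^ 2 * ξ 0) / d with hq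
  have hvar := sum_abs_arctan_quadratic_le (3 * d * ξ 0) (-3 * ξ 1) (ξ 2 / d) n q fun k => by
    simp only [hq]; field_simp; ring
  have hform : ∀ k : ℕ, shearedForm (k * d) (boxCoeff d 0) ξ =
      ξ 0 ^ 2 + (ξ 1 - 2 * (k * d) * ξ 0) ^ 2 + q k ^ 2 := fun k => by
    simp only [shearedForm_eq, boxCoeff, Matrix.cons_val_zero, Matrix.cons_val_one,
      Matrix.cons_val, hq, div_pow]
    field_simp
    ring
  -- The half of the Gaussian that remains has a form bounding a fixed multiple of `|ξ|²`, as `c`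
  -- and `d` are at most 1. The majorant therefore does not depend on `k`.
  have hG : ∀ k < n, Real.exp (-Real.pi / 2 * (ξ 0 ^ 2 + (ξ 1 - 2 * (k * d) * ξ 0) ^ 2 + q k ^ 2)) ≤
      Real.exp (-Real.pi * shearedForm 0 (fun _ => 1 / 100) ξ) := by
    intro k hkn
    refine Real.exp_le_exp.2 ?_
    have hc0 : 0 ≤ (k : ℝ) * d := by positivity
    have hc1 := hk k hkn
    have hp : ξ 2 = d * q k + 3 * (k * d) * (ξ 1 - 2 * (k * d) * ξ 0)
        + 3 * (k * d) ^ 2 * ξ 0 := by simp only [hq]; field_simp; ring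
    rw [shearedForm_eq]
    simp only [mul_zero, zero_mul, sub_zero, ne_eq, OfNat.ofNat_ne_zero, not_false_eq_true,
      zero_pow, add_zero]
    generalize hce : (k : ℝ) * d = c at *
    generalize hme : ξ 1 - 2 * c * ξ 0 = m at *
    have h1' : ξ 1 = m + 2 * c * ξ 0 := by rw [← hme]; ring
    have b1 : ξ 1 ^ 2 ≤ 2 * m ^ 2 + 8 * ξ 0 ^ 2 := by
      have : (2 * c * ξ 0) ^ 2 ≤ 4 * ξ 0 ^ 2 := by
        have : c ^ 2 ≤ 1 := by nlinarith
        nlinarith [sq_nonneg (ξ 0)]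
      rw [h1']
      nlinarith [sq_nonneg (m - 2 * c * ξ 0)]
    have b2 : ξ 2 ^ 2 ≤ 3 * (q k ^ 2 + 9 * m ^ 2 + 9 * ξ 0 ^ 2) := by
      have hc2 : c ^ 2 ≤ 1 := by nlinarith
      have e1 : (d * q k) ^ 2 ≤ q k ^ 2 := by
        have : d ^ 2 ≤ 1 := by nlinarith
        nlinarith [sq_nonneg (q k)]
      have e2 : (3 * c * m) ^ 2 ≤ 9 * m ^ 2 := by nlinarith [sq_nonneg m]
      have e3 : (3 * c ^ 2 * ξ 0) ^ 2 ≤ 9 * ξ 0 ^ 2 := by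
        have : (c ^ 2) ^ 2 ≤ 1 := by nlinarith [sq_nonneg c]
        nlinarith [sq_nonneg (ξ 0)]
      rw [hp]
      nlinarith [sq_nonneg (d * q k - 3 * c * m), sq_nonneg (d * q k - 3 * c ^ 2 * ξ 0),
        sq_nonneg (3 * c * m - 3 * c ^ 2 * ξ 0)]
    nlinarith [Real.pi_pos, sq_nonneg (ξ 0), sq_nonneg m, sq_nonneg (q k)]
  set G := Real.exp (-Real.pi * shearedForm 0 (fun _ => 1 / 100) ξ)
  calc _ ≤ ∑ k ∈ Finset.range n,
        (12 * |Real.arctan (q (k + 1)) - Real.arctan (q k)| + d) * G := by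
        refine Finset.sum_le_sum fun k hkn => ?_
        have hkn' := Finset.mem_range.1 hkn
        rw [hform]
        refine (abs_mul_exp_neg_le (q' := q (k + 1)) ?_ h0 h1).trans
          (mul_le_mul_of_nonneg_left (hG k hkn') (by positivity))
        simp only [hq]
        push_cast
        field_simp
        ring
    _ = (12 * ∑ k ∈ Finset.range n, |Real.arctan (q (k + 1)) - Real.arctan (q k)| + n * d) * G := by
        rw [← Finset.sum_mul, Finset.sum_add_distrib, ← Finset.mul_sum]
        simp
    -- Here `98 = 12 * 2 * 4 + 2`, from `π < 4` and `n * d ≤ 2`.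
    _ ≤ 98 * G := by
        refine mul_le_mul_of_nonneg_right ?_ (Real.exp_pos _).le
        nlinarith [Real.pi_lt_four]

/-! ### The high-pass multiplier and its dyadic majorant. -/

/-- With `z = 2 ^ j * m` the claim becomes scale-free: the difference gains `z²` for small `z`, and
the Gaussian absorbs the surplus `z³` for large `z`. -/
lemma sq_exp_sub_exp_le (m : ℝ) (hm : 0 ≤ m) (j : ℕ) :
    (Real.exp (-Real.pi * (4 ^ j * m ^ 2)) - Real.exp (-Real.pi * (4 ^ (j + 1) * m ^ 2))) ^ 2 ≤
      144 * m * (2 ^ j * Real.exp (-Real.pi * (4 ^ j * m ^ 2))) := by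
  have hz : (4 : ℝ) ^ j * m ^ 2 = (2 ^ j * m) ^ 2 := by
    rw [mul_pow, ← pow_mul, mul_comm j, pow_mul]; norm_num
  have hz' : (4 : ℝ) ^ (j + 1) * m ^ 2 = 4 * (2 ^ j * m) ^ 2 := by rw [pow_succ, ← hz]; ring
  rw [hz, hz', show 144 * m * (2 ^ j * Real.exp (-Real.pi * (2 ^ j * m) ^ 2)) =
    144 * (2 ^ j * m) * Real.exp (-Real.pi * (2 ^ j * m) ^ 2) by ring]
  have hz0 : 0 ≤ 2 ^ j * m := by positivity
  generalize 2 ^ j * m = z at *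
  set e := Real.exp (-Real.pi * z ^ 2) with he
  have he0 : 0 < e := Real.exp_pos _
  have h4 : Real.exp (-Real.pi * (4 * z ^ 2)) = e * Real.exp (-(3 * Real.pi * z ^ 2)) := by
    rw [he, ← Real.exp_add]; congr 1; ring
  have h5 : 1 - Real.exp (-(3 * Real.pi * z ^ 2)) ≤ 12 * z ^ 2 := by
    have := Real.one_sub_le_exp_neg (3 * Real.pi * z ^ 2)
    nlinarith [Real.pi_lt_four, sq_nonneg z]
  have h6 : 0 ≤ 1 - Real.exp (-(3 * Real.pi * z ^ 2)) := by
    rw [sub_nonneg, Real.exp_le_one_iff, neg_nonpos]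
    have := Real.pi_pos
    positivity
  have h7 : z ^ 3 * e ≤ 1 := by
    have h := one_add_sq_le_exp z
    have hee : e * (Real.exp (Real.pi / 2 * z ^ 2) * Real.exp (Real.pi / 2 * z ^ 2)) = 1 := by
      rw [he, ← Real.exp_add, ← Real.exp_add, Real.exp_eq_one_iff]; ring
    have h8 : (1 + z ^ 2) * (1 + z ^ 2) ≤
        Real.exp (Real.pi / 2 * z ^ 2) * Real.exp (Real.pi / 2 * z ^ 2) :=
      mul_le_mul h h (by positivity) (Real.exp_pos _).le
    have h9 : z ^ 3 ≤ (1 + z ^ 2) * (1 + z ^ 2) := by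
      nlinarith [mul_nonneg (sq_nonneg z) (sq_nonneg (z - 1)), sq_nonneg z]
    nlinarith
  rw [h4, show e - e * Real.exp (-(3 * Real.pi * z ^ 2)) =
    e * (1 - Real.exp (-(3 * Real.pi * z ^ 2))) by ring, mul_pow]
  calc e ^ 2 * (1 - Real.exp (-(3 * Real.pi * z ^ 2))) ^ 2 ≤ e ^ 2 * (12 * z ^ 2) ^ 2 := by gcongr
    _ = 144 * z * e * (z ^ 3 * e) := by ring
    _ ≤ 144 * z * e * 1 := by gcongr
    _ = _ := by ring

/-- Dyadic Gaussian majorant of the high-pass multiplier. -/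
lemma sq_one_sub_exp_le (m : ℝ) (hm : 0 ≤ m) (J : ℕ) :
    (1 - Real.exp (-Real.pi * (4 ^ J * m ^ 2))) ^ 2 ≤
      m * (144 * (J + 1) * (1 + ∑ j ∈ Finset.range J, 2 ^ j *
        Real.exp (-Real.pi * (4 ^ j * m ^ 2)))) := by
  set E : ℕ → ℝ := fun j => Real.exp (-Real.pi * (4 ^ j * m ^ 2)) with hE
  have h0 : (1 - E 0) ^ 2 ≤ 144 * m := by
    have hE1 : E 0 ≤ 1 := by
      simp only [hE]
      rw [Real.exp_le_one_iff]
      have := Real.pi_pos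
      have : 0 ≤ Real.pi * (4 ^ 0 * m ^ 2) := by positivity
      linarith
    have hE0 : 0 < E 0 := Real.exp_pos _
    rcases le_total m 1 with h | h
    · have : 1 - E 0 ≤ 4 * m ^ 2 := by
        have := Real.one_sub_le_exp_neg (Real.pi * (4 ^ 0 * m ^ 2))
        rw [← neg_mul] at this
        simp only [hE]
        nlinarith [Real.pi_lt_four, sq_nonneg m]
      have h2 : 4 * m ^ 2 ≤ 4 * m := by nlinarith
      nlinarith
    · nlinarith
  -- Telescoping into `J + 1` pieces: index `0` holds `1 - E 0`, and index `j + 1` the dyadic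
  -- difference `E j - E (j + 1)`. Cauchy–Schwarz then loses one factor `J + 1`.
  set f : ℕ → ℝ := fun j => if j = 0 then 1 - E 0 else E (j - 1) - E j with hf
  have hsum : 1 - E J = ∑ j ∈ Finset.range (J + 1), f j := by
    rw [Finset.sum_range_succ']
    simp only [hf, Nat.add_eq_zero_iff, one_ne_zero, and_false, if_false, if_true,
      Nat.add_sub_cancel]
    rw [Finset.sum_range_sub']
    ring
  have hcs := sq_sum_le_card_mul_sum_sq (s := Finset.range (J + 1)) (f := f)
  rw [← hsum, Finset.card_range, Finset.sum_range_succ'] at hcs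
  simp only [hf, Nat.add_eq_zero_iff, one_ne_zero, and_false, if_false, if_true,
      Nat.add_sub_cancel] at hcs
  refine hcs.trans ?_
  have h1 : ∑ j ∈ Finset.range J, (E j - E (j + 1)) ^ 2 ≤
      144 * m * ∑ j ∈ Finset.range J, 2 ^ j * E j := by
    rw [Finset.mul_sum]
    exact Finset.sum_le_sum fun j _ => sq_exp_sub_exp_le m hm j
  calc _ ≤ ((J + 1 : ℕ) : ℝ) * (144 * m * ∑ j ∈ Finset.range J, 2 ^ j * E j + 144 * m) := by
        gcongr
    _ = _ := by push_cast; ring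

/-- Weighted arithmetic-geometric mean inequality for a product of trigonometric sums. -/
lemma two_mul_le_of_sq_le {D W m P A B l : ℝ} (hm : 0 ≤ m) (hW : 0 ≤ W) (hA : 0 ≤ A)
    (hB : 0 ≤ B) (hl : 0 < l) (hD : D ^ 2 ≤ m * W) (hP : P ^ 2 ≤ A * B) :
    2 * (D * P) ≤ l * (m * A) + l⁻¹ * (W * B) := by
  refine le_of_abs_le (abs_le_of_sq_le_sq ?_ (by positivity))
  have h1 : (D * P) ^ 2 ≤ (m * W) * (A * B) := by
    rw [mul_pow]
    exact mul_le_mul hD hP (sq_nonneg _) (by positivity)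
  have h2 : l * (m * A) * (l⁻¹ * (W * B)) = m * W * (A * B) := by field_simp
  nlinarith [sq_nonneg (l * (m * A) - l⁻¹ * (W * B))]

/-! ### Box Gaussians in physical space and their waves in frequency space. -/

lemma frenetCoord_sub (c : ℝ) (x y : Fin 3 → ℝ) (i : Fin 3) :
    frenetCoord c (x - y) i = frenetCoord c x i - frenetCoord c y i := by
  fin_cases i <;> simp [frenetCoord] <;> ring

/-- The Gaussian adapted to the box with squared side lengths `b` in the Frenet frame at `c`. -/
def boxGaussian (c : ℝ) (b y : Fin 3 → ℝ) : ℝ :=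
  Real.exp (-Real.pi * ∑ i, frenetCoord c y i ^ 2 / b i)

/-- A Gaussian in frequency space, modulated by `y`. -/
def gaussianWave (c : ℝ) (b y ξ : Fin 3 → ℝ) : ℝ :=
  Real.cos (2 * Real.pi * ∑ i, ξ i * y i) * Real.exp (-Real.pi * shearedForm c b ξ)

lemma boxGaussian_pos (c : ℝ) (b y : Fin 3 → ℝ) : 0 < boxGaussian c b y := Real.exp_pos _

lemma boxCoeff_pos {d t : ℝ} (hd : 0 < d) (ht : 0 ≤ t) (i : Fin 3) : 0 < boxCoeff d t i := by
  fin_cases i <;> simp [boxCoeff] <;> positivity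

lemma integrable_gaussianWave (c : ℝ) {b : Fin 3 → ℝ} (hb : ∀ i, 0 < b i) (y : Fin 3 → ℝ) :
    Integrable (gaussianWave c b y) :=
  integrable_cos_mul_gaussian c b hb y

/-- The factor `(1 + t)^{-1/2}` shows that adding `t` to the normal coefficient averages the tube
Gaussian in the normal direction. -/
lemma integral_gaussianWave_box (c : ℝ) {d t : ℝ} (hd : 0 < d) (ht : 0 ≤ t) (y : Fin 3 → ℝ) :
    ∫ ξ, gaussianWave c (boxCoeff d t) y ξ =
      d * ((Real.sqrt (1 + t))⁻¹ * boxGaussian c (boxCoeff d t) y) := by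
  have h := integral_cos_mul_gaussian c (boxCoeff d t) (boxCoeff_pos hd ht) y
  simp only [gaussianWave, boxGaussian]
  rw [h, Fin.prod_univ_three]
  simp only [boxCoeff, Matrix.cons_val_zero, Matrix.cons_val_one, Matrix.cons_val, Real.sqrt_one,
    Real.sqrt_inv, Real.sqrt_sq hd.le, inv_one, inv_inv]
  ring

lemma integral_gaussianWave_isotropic (y : Fin 3 → ℝ) :
    ∫ ξ, gaussianWave 0 (fun _ => 1 / 100) y ξ =
      1000 * boxGaussian 0 (fun _ => 1 / 100) y := by
  have h := integral_cos_mul_gaussian 0 (fun _ => 1 / 100) (fun _ => by norm_num) y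
  simp only [gaussianWave, boxGaussian]
  rw [h, Fin.prod_univ_three, show (1 / 100 : ℝ) = (1 / 10) ^ 2 by norm_num,
    Real.sqrt_sq (by norm_num)]
  norm_num

/-- Scale the unit lattice by the side lengths of the box. Points in one cell lie in a box centred
at any one of them, and `1 + t ≤ 2 / d` puts that box inside a plank. -/
lemma sum_boxGaussian_le {τ : Type*} (T : Finset τ) (a : τ → Fin 3 → ℝ) {c d t P : ℝ}
    (hd : 0 < d) (hd1 : d ≤ 1) (ht : 0 ≤ t) (ht1 : t ≤ 1 / d) (hP0 : 0 ≤ P)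
    (hP : ∀ y : Fin 3 → ℝ, ((T.filter fun s => |frenetCoord c (a s - y) 0| ≤ 1 ∧
      |frenetCoord c (a s - y) 1| ≤ Real.sqrt (2 / d) ∧
      |frenetCoord c (a s - y) 2| ≤ 1 / d).card : ℝ) ≤ P) (y : Fin 3 → ℝ) :
    ∑ s ∈ T, boxGaussian c (boxCoeff d t) (y - a s) ≤ P * latticeMass := by
  classical
  have hb := boxCoeff_pos hd ht
  have hsq : ∀ i, 0 < Real.sqrt (boxCoeff d t i) := fun i => Real.sqrt_pos.2 (hb i)
  have h := sum_gaussian_le T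
    (fun s i => frenetCoord c (y - a s) i / Real.sqrt (boxCoeff d t i)) (P := P) (η := 1) hP0
    one_pos le_rfl fun m => ?_
  · simp only [inv_one, one_pow, one_mul, div_pow, Real.sq_sqrt (hb _).le] at h
    exact h
  · rcases (T.filter fun s => (fun j => ⌊frenetCoord c (y - a s) j /
        Real.sqrt (boxCoeff d t j)⌋) = m).eq_empty_or_nonempty with he | ⟨s₀, hs₀⟩
    · rw [he]; simpa using hP0
    · refine le_trans ?_ (hP (a s₀))
      refine Nat.cast_le.2 (Finset.card_le_card fun s hs => ?_)
      rw [Finset.mem_filter] at hs hs₀ ⊢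
      have key : ∀ i, |frenetCoord c (a s - a s₀) i| ≤ Real.sqrt (boxCoeff d t i) := by
        intro i
        have h1 := Int.abs_sub_lt_one_of_floor_eq_floor
          ((congrFun hs.2 i).trans (congrFun hs₀.2 i).symm)
        rw [← sub_div, abs_div, abs_of_pos (hsq i), div_lt_one (hsq i)] at h1
        rw [frenetCoord_sub] at h1 ⊢
        rw [frenetCoord_sub, abs_sub_comm] at h1
        refine le_trans (le_of_eq ?_) h1.le
        congr 1
        ring
      refine ⟨hs.1, ?_, ?_, ?_⟩
      · simpa [boxCoeff] using key 0
      · refine (key 1).trans (Real.sqrt_le_sqrt ?_)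
        simp only [boxCoeff, Matrix.cons_val_one, Matrix.cons_val_zero]
        have : 1 ≤ 1 / d := by rw [le_div_iff₀ hd]; linarith
        calc 1 + t ≤ 1 / d + 1 / d := by linarith
          _ = 2 / d := by ring
      · have := key 2
        simp only [boxCoeff, Matrix.cons_val, Real.sqrt_inv, Real.sqrt_sq hd.le] at this
        rwa [one_div]

/-- A lattice of mesh `1 / L` has at most one point per cell. In its units the decay rate may be
lowered to `L⁻²`, and `L ^ 6` is the cube of the inverse rate. -/
lemma sum_boxGaussian_isotropic_le {χ : Type*} (X : Finset χ) (x : χ → Fin 3 → ℝ) {L : ℝ}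
    (hL : 1 ≤ L) (hsep : ∀ p ∈ X, ∀ q ∈ X, (∀ i, |x p i - x q i| < 1 / L) → p = q)
    (y : Fin 3 → ℝ) :
    ∑ q ∈ X, boxGaussian 0 (fun _ => 1 / 100) (y - x q) ≤ L ^ 6 * latticeMass := by
  classical
  have hL0 : 0 < L := by linarith
  have h := sum_gaussian_le X (fun q i => L * (y i - x q i)) (P := 1) (η := (L ^ 2)⁻¹) zero_le_one
    (by positivity) (inv_le_one_of_one_le₀ (one_le_pow₀ hL)) fun m => ?_
  · refine le_trans (Finset.sum_le_sum fun q _ => ?_) (h.trans (le_of_eq ?_))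
    · refine Real.exp_le_exp.2 ?_
      rw [neg_mul, neg_mul, neg_le_neg_iff]
      refine mul_le_mul_of_nonneg_left (Finset.sum_le_sum fun i _ => ?_) Real.pi_pos.le
      have : frenetCoord 0 (y - x q) i = y i - x q i := by
        fin_cases i <;> simp [frenetCoord]
      rw [this, mul_pow, inv_mul_cancel_left₀ (by positivity)]
      change (y i - x q i) ^ 2 ≤ (y i - x q i) ^ 2 / (1 / 100)
      rw [le_div_iff₀ (by norm_num)]
      linarith [sq_nonneg (y i - x q i)]
    · rw [inv_inv]; ring
  · refine Nat.cast_le_one.2 (Finset.card_le_one.2 fun p hp q hq => ?_)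
    rw [Finset.mem_filter] at hp hq
    refine hsep p hp.1 q hq.1 fun i => ?_
    have h1 := Int.abs_sub_lt_one_of_floor_eq_floor
      ((congrFun hp.2 i).trans (congrFun hq.2 i).symm)
    rw [← mul_sub, abs_mul, abs_of_pos hL0, mul_comm, ← lt_div_iff₀ hL0, abs_sub_comm] at h1
    rwa [sub_sub_sub_cancel_left] at h1

/-! ### Exponential sums and the pointwise inequality in frequency. -/

lemma cos_dot_sub (ξ x y : Fin 3 → ℝ) :
    Real.cos (2 * Real.pi * ∑ i, ξ i * (x - y) i) =
      Real.cos (2 * Real.pi * ∑ i, ξ i * x i) * Real.cos (2 * Real.pi * ∑ i, ξ i * y i) +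
      Real.sin (2 * Real.pi * ∑ i, ξ i * x i) * Real.sin (2 * Real.pi * ∑ i, ξ i * y i) := by
  rw [← Real.cos_sub]
  congr 1
  simp only [Pi.sub_apply, mul_sub, Finset.sum_sub_distrib]

/-- This is the real part of one exponential sum times the conjugate of the other. When both
families coincide it is a squared modulus, hence nonnegative. -/
lemma sum_sum_cos_dot_sub {τ χ : Type*} (T : Finset τ) (a : τ → Fin 3 → ℝ) (X : Finset χ)
    (x : χ → Fin 3 → ℝ) (ξ : Fin 3 → ℝ) :
    ∑ s ∈ T, ∑ p ∈ X, Real.cos (2 * Real.pi * ∑ i, ξ i * (x p - a s) i) =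
      (∑ p ∈ X, Real.cos (2 * Real.pi * ∑ i, ξ i * x p i)) *
        (∑ s ∈ T, Real.cos (2 * Real.pi * ∑ i, ξ i * a s i)) +
      (∑ p ∈ X, Real.sin (2 * Real.pi * ∑ i, ξ i * x p i)) *
        (∑ s ∈ T, Real.sin (2 * Real.pi * ∑ i, ξ i * a s i)) := by
  simp only [cos_dot_sub, Finset.sum_add_distrib]
  rw [Finset.sum_mul_sum, Finset.sum_mul_sum, Finset.sum_comm,
    Finset.sum_comm (s := T) (t := X)]

/-- The dyadic majorant of the high-frequency part of the waves of the `k`-th direction. -/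
def dyadicWave (c d : ℝ) (J : ℕ) (y ξ : Fin 3 → ℝ) : ℝ :=
  144 * (J + 1) * (gaussianWave c (boxCoeff d 0) y ξ +
    ∑ j ∈ Finset.range J, 2 ^ j * gaussianWave c (boxCoeff d (4 ^ j)) y ξ)

/-- The high-pass multiplier `D` satisfies `D² ≤ m * W`; AM-GM with parameter `l` gives `m` to the
points and `W` to the tubes of this direction. -/
lemma two_mul_sum_wave_sub_le {τ χ : Type*} (T : Finset τ) (a : τ → Fin 3 → ℝ) (X : Finset χ)
    (x : χ → Fin 3 → ℝ) (c d : ℝ) (J : ℕ) {l : ℝ} (hl : 0 < l) (ξ : Fin 3 → ℝ) :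
    2 * ∑ s ∈ T, ∑ p ∈ X, (gaussianWave c (boxCoeff d 0) (x p - a s) ξ -
        gaussianWave c (boxCoeff d (4 ^ J)) (x p - a s) ξ) ≤
      l * (|ξ 1 - 2 * c * ξ 0| * Real.exp (-Real.pi * shearedForm c (boxCoeff d 0) ξ) *
        ∑ q ∈ X, ∑ p ∈ X, Real.cos (2 * Real.pi * ∑ i, ξ i * (x p - x q) i)) +
      l⁻¹ * ∑ s ∈ T, ∑ s' ∈ T, dyadicWave c d J (a s' - a s) ξ := by
  set E := Real.exp (-Real.pi * shearedForm c (boxCoeff d 0) ξ) with hE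
  set m := |ξ 1 - 2 * c * ξ 0| with hm
  have hEt : ∀ t, Real.exp (-Real.pi * shearedForm c (boxCoeff d t) ξ) =
      E * Real.exp (-Real.pi * (t * m ^ 2)) := fun t => by
    rw [shearedForm_boxCoeff, hE, ← Real.exp_add, hm, sq_abs]
    congr 1; ring
  have hD := sq_one_sub_exp_le m (abs_nonneg _) J
  set D := 1 - Real.exp (-Real.pi * (4 ^ J * m ^ 2)) with hDdef
  set W := 144 * ((J : ℝ) + 1) * (1 + ∑ j ∈ Finset.range J, 2 ^ j *
        Real.exp (-Real.pi * (4 ^ j * m ^ 2))) with hW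
  have hW0 : 0 ≤ W := mul_nonneg (by positivity)
    (add_nonneg zero_le_one (Finset.sum_nonneg fun j _ => by positivity))
  have hleft : ∑ s ∈ T, ∑ p ∈ X, (gaussianWave c (boxCoeff d 0) (x p - a s) ξ -
        gaussianWave c (boxCoeff d (4 ^ J)) (x p - a s) ξ) =
      E * (D * ∑ s ∈ T, ∑ p ∈ X, Real.cos (2 * Real.pi * ∑ i, ξ i * (x p - a s) i)) := by
    have hterm : ∀ y, gaussianWave c (boxCoeff d 0) y ξ - gaussianWave c (boxCoeff d (4 ^ J)) y ξ =
        E * D * Real.cos (2 * Real.pi * ∑ i, ξ i * y i) := fun y => by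
      rw [gaussianWave, gaussianWave, hEt (4 ^ J), ← hE, hDdef]
      ring
    simp only [hterm, ← Finset.mul_sum]
    rw [mul_assoc]
  have hright : ∑ s ∈ T, ∑ s' ∈ T, dyadicWave c d J (a s' - a s) ξ =
      E * (W * ∑ s ∈ T, ∑ s' ∈ T, Real.cos (2 * Real.pi * ∑ i, ξ i * (a s' - a s) i)) := by
    have hterm : ∀ y, dyadicWave c d J y ξ =
        E * W * Real.cos (2 * Real.pi * ∑ i, ξ i * y i) := fun y => by
      have hg : ∀ t, gaussianWave c (boxCoeff d t) y ξ = Real.cos (2 * Real.pi * ∑ i, ξ i * y i) *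
          (E * Real.exp (-Real.pi * (t * m ^ 2))) := fun t => by rw [gaussianWave, hEt]
      rw [dyadicWave]
      simp only [hg, zero_mul, mul_zero, Real.exp_zero, mul_one]
      generalize Real.cos (2 * Real.pi * ∑ i, ξ i * y i) = C
      have : ∑ j ∈ Finset.range J, 2 ^ j * (C * (E * Real.exp (-Real.pi * (4 ^ j * m ^ 2)))) =
          C * E * ∑ j ∈ Finset.range J, 2 ^ j * Real.exp (-Real.pi * (4 ^ j * m ^ 2)) := by
        rw [Finset.mul_sum]
        exact Finset.sum_congr rfl fun j _ => by ring
      rw [this, hW]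
      ring
    simp only [hterm, ← Finset.mul_sum]
    rw [mul_assoc]
  rw [hleft, hright, sum_sum_cos_dot_sub, sum_sum_cos_dot_sub, sum_sum_cos_dot_sub]
  set CX := ∑ p ∈ X, Real.cos (2 * Real.pi * ∑ i, ξ i * x p i)
  set SX := ∑ p ∈ X, Real.sin (2 * Real.pi * ∑ i, ξ i * x p i)
  set CT := ∑ s ∈ T, Real.cos (2 * Real.pi * ∑ i, ξ i * a s i)
  set ST := ∑ s ∈ T, Real.sin (2 * Real.pi * ∑ i, ξ i * a s i)
  have h := two_mul_le_of_sq_le (P := CX * CT + SX * ST) (A := CX * CX + SX * SX)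
    (B := CT * CT + ST * ST) (abs_nonneg _) hW0
    (add_nonneg (mul_self_nonneg _) (mul_self_nonneg _))
    (add_nonneg (mul_self_nonneg _) (mul_self_nonneg _)) hl hD
    -- Cauchy–Schwarz in the plane, through Lagrange's identity.
    (by nlinarith [sq_nonneg (CX * ST - SX * CT)])
  have hE0 : 0 ≤ E := (Real.exp_pos _).le
  calc _ = E * (2 * (D * (CX * CT + SX * ST))) := by ring
    _ ≤ E * _ := mul_le_mul_of_nonneg_left h hE0
    _ = _ := by ring

/-! ### Integration over frequency: the high-frequency estimate. -/

lemma integrable_dyadicWave (c : ℝ) {d : ℝ} (hd : 0 < d) (J : ℕ) (y : Fin 3 → ℝ) :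
    Integrable (dyadicWave c d J y) := by
  unfold dyadicWave
  refine Integrable.const_mul ((integrable_gaussianWave c (boxCoeff_pos hd le_rfl) y).add
    (integrable_finsetSum _ fun j _ => ?_)) _
  exact (integrable_gaussianWave c (boxCoeff_pos hd (by positivity)) y).const_mul _

/-- The weight `2 ^ j` is cancelled by the normalisation `(1 + 4 ^ j)^{-1/2}`, so every dyadic scale
counts tubes in planks with weight at most 1. -/
lemma integral_dyadicWave_le (c : ℝ) {d : ℝ} (hd : 0 < d) (J : ℕ) (y : Fin 3 → ℝ) :
    ∫ ξ, dyadicWave c d J y ξ ≤ 144 * (J + 1) * (d * (boxGaussian c (boxCoeff d 0) y +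
      ∑ j ∈ Finset.range J, boxGaussian c (boxCoeff d (4 ^ j)) y)) := by
  unfold dyadicWave
  have hi : ∀ j ∈ Finset.range J, Integrable fun ξ =>
      2 ^ j * gaussianWave c (boxCoeff d (4 ^ j)) y ξ := fun j _ =>
    (integrable_gaussianWave c (boxCoeff_pos hd (by positivity)) y).const_mul _
  rw [integral_const_mul, integral_add (integrable_gaussianWave c (boxCoeff_pos hd le_rfl) y)
    (integrable_finsetSum _ hi), integral_finsetSum _ hi,
    integral_gaussianWave_box c hd le_rfl]
  refine mul_le_mul_of_nonneg_left ?_ (by positivity)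
  rw [mul_add, Finset.mul_sum]
  refine add_le_add (le_of_eq (by simp)) (Finset.sum_le_sum fun j _ => ?_)
  rw [integral_const_mul, integral_gaussianWave_box c hd (t := 4 ^ j) (by positivity), mul_left_comm]
  refine mul_le_mul_of_nonneg_left ?_ hd.le
  have h1 : (2 : ℝ) ^ j ≤ Real.sqrt (1 + 4 ^ j) := by
    refine Real.le_sqrt_of_sq_le ?_
    rw [← pow_mul, mul_comm, pow_mul]
    norm_num
  have h2 : 0 < Real.sqrt (1 + (4 : ℝ) ^ j) := lt_of_lt_of_le (by positivity) h1
  rw [← mul_assoc, ← div_eq_mul_inv]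
  exact mul_le_of_le_one_left (boxGaussian_pos _ _ _).le ((div_le_one h2).2 h1)

/-- The high-frequency estimate for a family of tubes with directions `k * d`. -/
lemma sum_highFrequency_le {τ χ : Type*} (T : ℕ → Finset τ) (a : τ → Fin 3 → ℝ) (X : Finset χ)
    (x : χ → Fin 3 → ℝ) {d P L l : ℝ} {n J : ℕ} (h0 : 0 < d) (h1 : d ≤ 1) (hn : n * d ≤ 2)
    (hk : ∀ k < n, k * d ≤ 1) (hJ : (4 : ℝ) ^ J ≤ 1 / d) (hP0 : 0 ≤ P) (hL : 1 ≤ L) (hl : 0 < l)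
    (hP : ∀ k < n, ∀ y : Fin 3 → ℝ, (((T k).filter fun s => |frenetCoord (k * d) (a s - y) 0| ≤ 1 ∧
      |frenetCoord (k * d) (a s - y) 1| ≤ Real.sqrt (2 / d) ∧
      |frenetCoord (k * d) (a s - y) 2| ≤ 1 / d).card : ℝ) ≤ P)
    (hsep : ∀ p ∈ X, ∀ q ∈ X, (∀ i, |x p i - x q i| < 1 / L) → p = q) :
    2 * ∑ k ∈ Finset.range n, ∑ s ∈ T k, ∑ p ∈ X,
        d * (boxGaussian (k * d) (boxCoeff d 0) (x p - a s) -
          (Real.sqrt (1 + 4 ^ J))⁻¹ * boxGaussian (k * d) (boxCoeff d (4 ^ J)) (x p - a s)) ≤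
      l * (98000 * L ^ 6 * latticeMass * X.card) +
      l⁻¹ * (144 * (J + 1) ^ 2 * d * P * latticeMass * ∑ k ∈ Finset.range n, ((T k).card : ℝ)) := by
  have hiT : ∀ (c t : ℝ) (y : Fin 3 → ℝ), 0 ≤ t → Integrable (gaussianWave c (boxCoeff d t) y) :=
    fun c t y ht => integrable_gaussianWave c (boxCoeff_pos h0 ht) y
  have hiX : ∀ y : Fin 3 → ℝ, Integrable (gaussianWave 0 (fun _ => 1 / 100) y) :=
    integrable_gaussianWave 0 fun _ => by norm_num
  have h4 : (0 : ℝ) ≤ 4 ^ J := by positivity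
  have hsub : ∀ (c : ℝ) (y : Fin 3 → ℝ), Integrable fun ξ => gaussianWave c (boxCoeff d 0) y ξ -
      gaussianWave c (boxCoeff d (4 ^ J)) y ξ := fun c y =>
    (hiT c 0 y le_rfl).sub (hiT c _ y h4)
  have hsub2 : ∀ k s, Integrable fun ξ => ∑ p ∈ X,
      (gaussianWave (k * d) (boxCoeff d 0) (x p - a s) ξ -
        gaussianWave (k * d) (boxCoeff d (4 ^ J)) (x p - a s) ξ) := fun k s =>
    integrable_finsetSum _ fun p _ => hsub _ _
  have hsub3 : ∀ k : ℕ, Integrable fun ξ => ∑ s ∈ T k, ∑ p ∈ X,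
      (gaussianWave (k * d) (boxCoeff d 0) (x p - a s) ξ -
        gaussianWave (k * d) (boxCoeff d (4 ^ J)) (x p - a s) ξ) := fun k =>
    integrable_finsetSum _ fun s _ => hsub2 _ _
  have hX2 : ∀ q, Integrable fun ξ => ∑ p ∈ X, gaussianWave 0 (fun _ => 1 / 100) (x p - x q) ξ :=
    fun q => integrable_finsetSum _ fun p _ => hiX _
  have hX3 : Integrable fun ξ => ∑ q ∈ X, ∑ p ∈ X,
      gaussianWave 0 (fun _ => 1 / 100) (x p - x q) ξ :=
    integrable_finsetSum _ fun q _ => hX2 q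
  have hT2 : ∀ (k : ℕ) s, Integrable fun ξ => ∑ s' ∈ T k, dyadicWave (k * d) d J (a s' - a s) ξ :=
    fun k s => integrable_finsetSum _ fun s' _ => integrable_dyadicWave _ h0 J _
  have hT3 : ∀ k : ℕ, Integrable fun ξ => ∑ s ∈ T k, ∑ s' ∈ T k,
      dyadicWave (k * d) d J (a s' - a s) ξ :=
    fun k => integrable_finsetSum _ fun s _ => hT2 k s
  have hpt : ∀ ξ, 2 * ∑ k ∈ Finset.range n, ∑ s ∈ T k, ∑ p ∈ X,
      (gaussianWave (k * d) (boxCoeff d 0) (x p - a s) ξ -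
        gaussianWave (k * d) (boxCoeff d (4 ^ J)) (x p - a s) ξ) ≤
      l * 98 * (∑ q ∈ X, ∑ p ∈ X, gaussianWave 0 (fun _ => 1 / 100) (x p - x q) ξ) +
      l⁻¹ * ∑ k ∈ Finset.range n, ∑ s ∈ T k, ∑ s' ∈ T k,
        dyadicWave (k * d) d J (a s' - a s) ξ := by
    intro ξ
    rw [Finset.mul_sum]
    refine (Finset.sum_le_sum fun k _ =>
      two_mul_sum_wave_sub_le (T k) a X x (k * d) d J hl ξ).trans ?_
    rw [Finset.sum_add_distrib, ← Finset.mul_sum, ← Finset.mul_sum, ← Finset.sum_mul, mul_assoc l]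
    refine add_le_add (mul_le_mul_of_nonneg_left ?_ hl.le) le_rfl
    -- The points' factor is the same nonnegative quantity for every direction, so the overlap bound
    -- can be multiplied by it.
    have hA : 0 ≤ ∑ q ∈ X, ∑ p ∈ X, Real.cos (2 * Real.pi * ∑ i, ξ i * (x p - x q) i) := by
      rw [sum_sum_cos_dot_sub]
      exact add_nonneg (mul_self_nonneg _) (mul_self_nonneg _)
    refine (mul_le_mul_of_nonneg_right (sum_abs_normal_mul_exp_le h0 h1 hn hk ξ) hA).trans
      (le_of_eq ?_)
    simp only [gaussianWave, ← Finset.sum_mul]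
    ring
  have hint := integral_mono ((integrable_finsetSum (Finset.range n) fun k _ => hsub3 k).const_mul 2)
    ((hX3.const_mul (l * 98)).add
      ((integrable_finsetSum (Finset.range n) fun k _ => hT3 k).const_mul l⁻¹)) hpt
  have eL : ∫ ξ, 2 * ∑ k ∈ Finset.range n, ∑ s ∈ T k, ∑ p ∈ X,
      (gaussianWave (k * d) (boxCoeff d 0) (x p - a s) ξ -
        gaussianWave (k * d) (boxCoeff d (4 ^ J)) (x p - a s) ξ) =
      2 * ∑ k ∈ Finset.range n, ∑ s ∈ T k, ∑ p ∈ X,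
        d * (boxGaussian (k * d) (boxCoeff d 0) (x p - a s) -
          (Real.sqrt (1 + 4 ^ J))⁻¹ * boxGaussian (k * d) (boxCoeff d (4 ^ J)) (x p - a s)) := by
    rw [integral_const_mul, integral_finsetSum _ fun k _ => hsub3 k]
    congr 1
    refine Finset.sum_congr rfl fun k _ => ?_
    rw [integral_finsetSum _ fun s _ => hsub2 k s]
    refine Finset.sum_congr rfl fun s _ => ?_
    rw [integral_finsetSum _ fun p _ => hsub _ _]
    refine Finset.sum_congr rfl fun p _ => ?_
    rw [integral_sub (hiT _ _ _ le_rfl) (hiT _ _ _ h4), integral_gaussianWave_box _ h0 le_rfl,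
      integral_gaussianWave_box _ h0 h4]
    simp only [add_zero, Real.sqrt_one, inv_one, one_mul]
    ring
  have eR : ∫ ξ, (l * 98 * (∑ q ∈ X, ∑ p ∈ X, gaussianWave 0 (fun _ => 1 / 100) (x p - x q) ξ) +
      l⁻¹ * ∑ k ∈ Finset.range n, ∑ s ∈ T k, ∑ s' ∈ T k,
        dyadicWave (k * d) d J (a s' - a s) ξ) =
      l * 98 * (∑ q ∈ X, ∑ p ∈ X, 1000 * boxGaussian 0 (fun _ => 1 / 100) (x p - x q)) +
      l⁻¹ * ∑ k ∈ Finset.range n, ∑ s ∈ T k, ∑ s' ∈ T k,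
        ∫ ξ, dyadicWave (k * d) d J (a s' - a s) ξ := by
    rw [integral_add (hX3.const_mul _)
      ((integrable_finsetSum (Finset.range n) fun k _ => hT3 k).const_mul l⁻¹),
      integral_const_mul, integral_const_mul, integral_finsetSum _ fun q _ => hX2 q,
      integral_finsetSum _ fun k _ => hT3 k]
    congr 2
    · refine Finset.sum_congr rfl fun q _ => ?_
      rw [integral_finsetSum _ fun p _ => hiX _]
      exact Finset.sum_congr rfl fun p _ => integral_gaussianWave_isotropic _
    · refine Finset.sum_congr rfl fun k _ => ?_
      rw [integral_finsetSum _ fun s _ => hT2 k s]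
      refine Finset.sum_congr rfl fun s _ => ?_
      rw [integral_finsetSum _ fun s' _ => integrable_dyadicWave _ h0 J _]
  simp only [Pi.add_apply] at hint
  rw [← eL]
  refine hint.trans ?_
  rw [eR]
  refine add_le_add ?_ (mul_le_mul_of_nonneg_left ?_ (inv_nonneg.2 hl.le))
  · rw [mul_assoc]
    refine mul_le_mul_of_nonneg_left ?_ hl.le
    have : ∑ q ∈ X, ∑ p ∈ X, 1000 * boxGaussian 0 (fun _ => 1 / 100) (x p - x q) ≤
        ∑ q ∈ X, 1000 * (L ^ 6 * latticeMass) := by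
      rw [Finset.sum_comm]
      refine Finset.sum_le_sum fun p _ => ?_
      rw [← Finset.mul_sum]
      exact mul_le_mul_of_nonneg_left (sum_boxGaussian_isotropic_le X x hL hsep (x p)) (by norm_num)
    rw [Finset.sum_const, nsmul_eq_mul] at this
    linarith
  · rw [Finset.mul_sum]
    refine Finset.sum_le_sum fun k hkn => ?_
    rw [Finset.mem_range] at hkn
    have hone : (0 : ℝ) ≤ 1 / d := by positivity
    -- One factor `J + 1` comes from Cauchy–Schwarz in the majorant, the other from its `J + 1`
    -- Gaussians, each bounded by the plank count.
    have hbound : ∀ s' ∈ T k, ∑ s ∈ T k, ∫ ξ, dyadicWave (k * d) d J (a s' - a s) ξ ≤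
        144 * (J + 1) ^ 2 * d * P * latticeMass := by
      intro s' _
      refine (Finset.sum_le_sum fun s _ => integral_dyadicWave_le (k * d) h0 J _).trans ?_
      rw [← Finset.mul_sum, ← Finset.mul_sum, Finset.sum_add_distrib, Finset.sum_comm]
      have b0 := sum_boxGaussian_le (T k) a h0 h1 le_rfl hone hP0 (hP k hkn) (a s')
      have bj : ∑ j ∈ Finset.range J, ∑ s ∈ T k,
          boxGaussian (k * d) (boxCoeff d (4 ^ j)) (a s' - a s) ≤
          ∑ j ∈ Finset.range J, P * latticeMass := by
        refine Finset.sum_le_sum fun j hj => ?_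
        rw [Finset.mem_range] at hj
        exact sum_boxGaussian_le (T k) a h0 h1 (by positivity)
          ((pow_le_pow_right₀ (by norm_num) hj.le).trans hJ) hP0 (hP k hkn) (a s')
      rw [Finset.sum_const, Finset.card_range, nsmul_eq_mul] at bj
      calc _ ≤ 144 * ((J : ℝ) + 1) * (d * (P * latticeMass + J * (P * latticeMass))) := by gcongr
        _ = _ := by ring
    rw [Finset.sum_comm]
    refine (Finset.sum_le_sum hbound).trans (le_of_eq ?_)
    rw [Finset.sum_const, nsmul_eq_mul]
    ring

/-! ### The incidence estimate for points and tubes. -/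

/-- Incidence estimate for unit-separated points and `(1, 1, d⁻¹)`-tubes with directions `k * d`,
in terms of the number of tubes in `(1, d^{-1/2}, d⁻¹)`-planks. -/
theorem card_rich_points_le {τ χ : Type*} (T : ℕ → Finset τ) (a : τ → Fin 3 → ℝ) (X : Finset χ)
    (x : χ → Fin 3 → ℝ) {d P L κ r : ℝ} {n J : ℕ} (h0 : 0 < d) (h1 : d ≤ 1) (hn : n * d ≤ 2)
    (hk : ∀ k < n, k * d ≤ 1) (hJ : (4 : ℝ) ^ J ≤ 1 / d) (hJ' : 1 / d < (4 : ℝ) ^ (J + 1))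
    (hP0 : 0 ≤ P) (hL : 1 ≤ L) (hr0 : 0 < r)
    (hP : ∀ k < n, ∀ y : Fin 3 → ℝ, (((T k).filter fun s => |frenetCoord (k * d) (a s - y) 0| ≤ 1 ∧
      |frenetCoord (k * d) (a s - y) 1| ≤ Real.sqrt (2 / d) ∧
      |frenetCoord (k * d) (a s - y) 2| ≤ 1 / d).card : ℝ) ≤ P)
    (hsep : ∀ p ∈ X, ∀ q ∈ X, (∀ i, |x p i - x q i| < 1 / L) → p = q)
    (hrich : ∀ p ∈ X, r ≤ ∑ k ∈ Finset.range n, (((T k).filter fun s =>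
      ∑ i, frenetCoord (k * d) (x p - a s) i ^ 2 / boxCoeff d 0 i ≤ κ).card : ℝ))
    (hr : 8 * P * latticeMass ≤ Real.exp (-Real.pi * κ) * r * Real.sqrt d) :
    Real.exp (-Real.pi * κ) ^ 2 * (r ^ 2 * d * X.card) ≤
      576 * (98000 * L ^ 6 * (latticeMass + 1)) * latticeMass *
        ((J + 1) ^ 2 * P * ∑ k ∈ Finset.range n, ((T k).card : ℝ)) := by
  have hM := latticeMass_nonneg
  set e := Real.exp (-Real.pi * κ) with he
  have he0 : 0 < e := Real.exp_pos _
  set B := 98000 * L ^ 6 * (latticeMass + 1) with hB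
  have hB0 : 0 < B := by positivity
  set S := ∑ k ∈ Finset.range n, ((T k).card : ℝ)
  have hS0 : 0 ≤ S := Finset.sum_nonneg fun k _ => Nat.cast_nonneg _
  -- This value of the AM-GM parameter makes the points' term at most half of the lower bound `e * r
  -- * d * X.card` for the left side, so that it can be absorbed. The `+ 1` in `B` keeps the
  -- denominator positive.
  have hl : 0 < e * r * d / (2 * B) := by positivity
  have hH := sum_highFrequency_le T a X x h0 h1 hn hk hJ hP0 hL hl hP hsep
  have hsd : 0 < Real.sqrt d := Real.sqrt_pos.2 h0
  have hsd2 : Real.sqrt d * Real.sqrt d = d := Real.mul_self_sqrt h0.le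
  -- `J` is maximal with `4 ^ J ≤ 1 / d`, so the averaging length is comparable to `d^{-1/2}`.
  have hroot : (Real.sqrt (1 + 4 ^ J))⁻¹ ≤ 2 * Real.sqrt d := by
    have : 1 / (2 * Real.sqrt d) ≤ Real.sqrt (1 + 4 ^ J) := by
      refine Real.le_sqrt_of_sq_le ?_
      rw [div_pow, mul_pow, Real.sq_sqrt h0.le, one_pow]
      rw [pow_succ] at hJ'
      have : 1 / (2 ^ 2 * d) = 1 / d / 4 := by field_simp; norm_num
      linarith
    rw [inv_le_comm₀ (by positivity) (by positivity)]
    rwa [one_div] at this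
  have hpoint : ∀ p ∈ X, d * (e * r / 2) ≤ ∑ k ∈ Finset.range n, ∑ s ∈ T k,
        d * (boxGaussian (k * d) (boxCoeff d 0) (x p - a s) -
          (Real.sqrt (1 + 4 ^ J))⁻¹ * boxGaussian (k * d) (boxCoeff d (4 ^ J)) (x p - a s)) := by
    intro p hp
    simp only [← Finset.mul_sum, Finset.sum_sub_distrib]
    refine mul_le_mul_of_nonneg_left ?_ h0.le
    -- A tube counted by `hrich` has its Gaussian at least `e` at `x p`.
    have hhigh : e * r ≤ ∑ k ∈ Finset.range n, ∑ s ∈ T k,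
        boxGaussian (k * d) (boxCoeff d 0) (x p - a s) := by
      refine (mul_le_mul_of_nonneg_left (hrich p hp) he0.le).trans ?_
      rw [Finset.mul_sum]
      refine Finset.sum_le_sum fun k _ => ?_
      refine le_trans ?_ (Finset.sum_le_sum_of_subset_of_nonneg (Finset.filter_subset (fun s =>
        ∑ i, frenetCoord (k * d) (x p - a s) i ^ 2 / boxCoeff d 0 i ≤ κ) (T k))
        fun s _ _ => (boxGaussian_pos _ _ _).le)
      rw [mul_comm, ← nsmul_eq_mul]
      refine Finset.card_nsmul_le_sum _ _ _ fun s hs => ?_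
      refine Real.exp_le_exp.2 ?_
      have := (Finset.mem_filter.1 hs).2
      nlinarith [Real.pi_pos]
    -- At most `2 / d` directions, each contributing `2 * √d * P * latticeMass`; `hr` says that the
    -- total is at most half of `e * r`.
    have hlow : ∑ k ∈ Finset.range n, (Real.sqrt (1 + 4 ^ J))⁻¹ * ∑ s ∈ T k,
        boxGaussian (k * d) (boxCoeff d (4 ^ J)) (x p - a s) ≤ e * r / 2 := by
      have : ∀ k ∈ Finset.range n, (Real.sqrt (1 + 4 ^ J))⁻¹ * ∑ s ∈ T k,
          boxGaussian (k * d) (boxCoeff d (4 ^ J)) (x p - a s) ≤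
          2 * Real.sqrt d * (P * latticeMass) := fun k hkn =>
        mul_le_mul hroot (sum_boxGaussian_le (T k) a h0 h1 (by positivity) hJ hP0
          (hP k (Finset.mem_range.1 hkn)) (x p))
          (Finset.sum_nonneg fun s _ => (boxGaussian_pos _ _ _).le) (by positivity)
      refine (Finset.sum_le_sum this).trans ?_
      rw [Finset.sum_const, Finset.card_range, nsmul_eq_mul]
      have hPM : 0 ≤ P * latticeMass := by positivity
      have h3 : n * (2 * Real.sqrt d * (P * latticeMass)) * Real.sqrt d ≤
          e * r / 2 * Real.sqrt d := by
        calc n * (2 * Real.sqrt d * (P * latticeMass)) * Real.sqrt d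
            = 2 * (n * (Real.sqrt d * Real.sqrt d)) * (P * latticeMass) := by ring
          _ ≤ 2 * 2 * (P * latticeMass) := by rw [hsd2]; gcongr
          _ ≤ e * r / 2 * Real.sqrt d := by linarith
      exact le_of_mul_le_mul_right h3 hsd
    simp only [Finset.mul_sum] at hlow ⊢
    linarith
  have hsumX : X.card * (d * (e * r / 2)) ≤ ∑ k ∈ Finset.range n, ∑ s ∈ T k, ∑ p ∈ X,
        d * (boxGaussian (k * d) (boxCoeff d 0) (x p - a s) -
          (Real.sqrt (1 + 4 ^ J))⁻¹ * boxGaussian (k * d) (boxCoeff d (4 ^ J)) (x p - a s)) := by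
    rw [← nsmul_eq_mul]
    refine (Finset.card_nsmul_le_sum X _ _ hpoint).trans (le_of_eq ?_)
    rw [Finset.sum_comm]
    exact Finset.sum_congr rfl fun k _ => Finset.sum_comm
  have h2 := (mul_le_mul_of_nonneg_left hsumX zero_le_two).trans hH
  have hfirst : e * r * d / (2 * B) * (98000 * L ^ 6 * latticeMass * X.card) ≤
      e * r * d / 2 * X.card := by
    calc _ ≤ e * r * d / (2 * B) * (B * X.card) := by
          rw [hB]; gcongr; linarith
      _ = _ := by field_simp
  have h3 : e * r * d / 2 * X.card ≤ (e * r * d / (2 * B))⁻¹ *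
      (144 * (J + 1) ^ 2 * d * P * latticeMass * S) := by linarith
  have h4 : (e * r * d / (2 * B))⁻¹ * (144 * (J + 1) ^ 2 * d * P * latticeMass * S) =
      288 * B * latticeMass * ((J + 1) ^ 2 * P * S) / (e * r) := by
    field_simp
    ring
  rw [h4, le_div_iff₀ (by positivity)] at h3
  linarith

/-! ### Counting boxes and tubes near a given box. -/

lemma mem_vinogradovBox_iff {c d₁ d₂ d₃ : ℝ} {a x : E3} :
    x ∈ vinogradovBox c d₁ d₂ d₃ a ↔ |frenetCoord c (fun i => x i - a i) 0| ≤ d₁ ∧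
      |frenetCoord c (fun i => x i - a i) 1| ≤ d₂ ∧
      |frenetCoord c (fun i => x i - a i) 2| ≤ d₃ := Iff.rfl

lemma frenetCoord_div (c ρ : ℝ) (y : Fin 3 → ℝ) (i : Fin 3) :
    frenetCoord c (fun j => y j / ρ) i = frenetCoord c y i / ρ := by
  fin_cases i <;> simp [frenetCoord] <;> ring

lemma exists_frenetCoord_eq (c : ℝ) (z : Fin 3 → ℝ) :
    ∃ x : E3, ∀ i, frenetCoord c (fun j => x j) i = z i := by
  refine ⟨!₂[z 0 - 2 * c * z 1 + 3 * c ^ 2 * z 2, z 1 - 3 * c * z 2, z 2], fun i => ?_⟩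
  fin_cases i <;> simp [frenetCoord] <;> ring

lemma center_mem_of_isVinogradovBox {c d₁ d₂ d₃ : ℝ} {a : E3} {S : Set E3} (h₁ : 0 ≤ d₁)
    (h₂ : 0 ≤ d₂) (h₃ : 0 ≤ d₃) (h : vinogradovBox c d₁ d₂ d₃ a ⊆ S) : a ∈ S := by
  refine h (mem_vinogradovBox_iff.2 ?_)
  simp [frenetCoord, h₁, h₂, h₃]

lemma card_int_Icc_floor_le {z M : ℝ} (hM : 0 ≤ M) :
    ((Finset.Icc ⌊z - M⌋ ⌊z + M⌋).card : ℝ) ≤ 2 * M + 2 := by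
  have h1 := Int.floor_le (z + M)
  have h2 := Int.lt_floor_add_one (z - M)
  have h3 : ⌊z - M⌋ ≤ ⌊z + M⌋ := Int.floor_le_floor (by linarith)
  rw [Int.card_Icc]
  have : (((⌊z + M⌋ + 1 - ⌊z - M⌋).toNat : ℤ) : ℝ) = ((⌊z + M⌋ + 1 - ⌊z - M⌋ : ℤ) : ℝ) := by
    rw [Int.toNat_of_nonneg (by omega)]
  rw [Int.cast_natCast] at this
  rw [this]
  push_cast
  linarith

/-- Boundedly many members of a boundedly overlapping family of boxes have their centre close to a
given point. -/
lemma card_le_of_boundedOverlap {A c M : ℝ} (hA : 1 ≤ A) (hM : 0 ≤ M) {D : Fin 3 → ℝ}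
    (hD : ∀ i, 0 < D i) {F : Set (Set E3)} (hF : BoundedOverlap A F) (G : Finset (Set E3))
    (hG : ∀ S ∈ G, S ∈ F) (b : Set E3 → E3)
    (hb : ∀ S ∈ G, vinogradovBox c (A⁻¹ * D 0) (A⁻¹ * D 1) (A⁻¹ * D 2) (b S) ⊆ S) (z : Fin 3 → ℝ)
    (hz : ∀ S ∈ G, ∀ i, |frenetCoord c (fun j => b S j) i - z i| ≤ M * D i) :
    (G.card : ℝ) ≤ A * (2 * (A * M) + 2) ^ 3 := by
  classical
  have hA0 : 0 < A := by linarith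
  have hmem : ∀ S ∈ G, (fun i => ⌊A * (frenetCoord c (fun j => b S j) i / D i)⌋) ∈
      Fintype.piFinset fun i : Fin 3 =>
        Finset.Icc ⌊A * (z i / D i) - A * M⌋ ⌊A * (z i / D i) + A * M⌋ := by
    intro S hS
    rw [Fintype.mem_piFinset]
    intro i
    have h := abs_le.1 (hz S hS i)
    have hDi := hD i
    have h1 : z i / D i - M ≤ frenetCoord c (fun j => b S j) i / D i := by
      rw [le_div_iff₀ hDi, sub_mul, div_mul_cancel₀ _ hDi.ne']; linarith
    have h2 : frenetCoord c (fun j => b S j) i / D i ≤ z i / D i + M := by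
      rw [div_le_iff₀ hDi, add_mul, div_mul_cancel₀ _ hDi.ne']; linarith
    rw [Finset.mem_Icc, ← mul_sub, ← mul_add]
    exact ⟨Int.floor_le_floor (mul_le_mul_of_nonneg_left h1 hA0.le),
      Int.floor_le_floor (mul_le_mul_of_nonneg_left h2 hA0.le)⟩
  have hfib : ∀ m ∈ Fintype.piFinset fun i : Fin 3 =>
        Finset.Icc ⌊A * (z i / D i) - A * M⌋ ⌊A * (z i / D i) + A * M⌋,
      (G.filter fun S => (fun i => ⌊A * (frenetCoord c (fun j => b S j) i / D i)⌋) = m).card ≤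
        ⌊A⌋₊ := by
    intro m _
    -- `x` is the lower corner of the cell `m`, of sides `D i / A`. Every box centred in that cell
    -- contains `x`, so bounded overlap limits their number.
    obtain ⟨x, hx⟩ := exists_frenetCoord_eq c fun i => m i * D i / A
    obtain ⟨hfin, hcard⟩ := hF x
    refine Nat.le_floor (le_trans ?_ hcard)
    rw [← Set.ncard_coe_finset]
    refine Nat.cast_le.2 (Set.ncard_le_ncard (fun S hS => ?_) hfin)
    rw [Finset.mem_coe, Finset.mem_filter] at hS
    refine ⟨hG S hS.1, hb S hS.1 (mem_vinogradovBox_iff.2 ?_)⟩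
    have key : ∀ i, |frenetCoord c (fun j => x j - b S j) i| ≤ A⁻¹ * D i := by
      intro i
      have e := frenetCoord_sub c (fun j => x j) (fun j => b S j) i
      rw [show (fun j => x j - b S j) = (fun j => x j) - (fun j => b S j) from rfl, e, hx,
        ← congrFun hS.2 i]
      have hDi := hD i
      set w := frenetCoord c (fun j => b S j) i
      have h1 := Int.floor_le (A * (w / D i))
      have h2 := Int.lt_floor_add_one (A * (w / D i))
      set f : ℝ := (⌊A * (w / D i)⌋ : ℝ)
      have hw : w = A * (w / D i) * D i / A := by field_simp
      rw [hw, ← sub_div, ← sub_mul, abs_div, abs_mul, abs_of_pos hDi, abs_of_pos hA0,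
        inv_mul_eq_div]
      refine div_le_div_of_nonneg_right ?_ hA0.le
      refine mul_le_of_le_one_left hDi.le (abs_le.2 ⟨?_, ?_⟩)
      · linarith
      · linarith
    exact ⟨key 0, key 1, key 2⟩
  have h := Finset.card_le_mul_card_image_of_maps_to hmem _ hfib
  rw [Fintype.card_piFinset] at h
  have h' : (G.card : ℝ) ≤ (⌊A⌋₊ : ℝ) * ∏ i : Fin 3,
      ((Finset.Icc ⌊A * (z i / D i) - A * M⌋ ⌊A * (z i / D i) + A * M⌋).card : ℝ) := by
    exact_mod_cast h
  refine h'.trans (mul_le_mul (Nat.floor_le hA0.le) ?_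
    (Finset.prod_nonneg fun i _ => Nat.cast_nonneg _) hA0.le)
  calc _ ≤ ∏ i : Fin 3, (2 * (A * M) + 2) := Finset.prod_le_prod (fun i _ => Nat.cast_nonneg _)
        fun i _ => card_int_Icc_floor_le (by positivity)
    _ = _ := by simp

/-- Boundedly many boxes of the cover, hence `O(N)` tubes, meet a given box of the same shape. -/
lemma card_tubes_in_box_le {A R : ℝ} (hA : 1 ≤ A) {D : Fin 3 → ℝ}
    (hD : ∀ i, 0 < D i) {𝕋 : Finset (ℕ × Set E3)} {N k : ℕ}
    (hS : SpacingCondition A R (D 0) (D 1) (D 2) 𝕋 N) (hk : leftEnd R k < 1)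
    (cen : ℕ × Set E3 → E3) (hcen : ∀ p ∈ 𝕋, cen p ∈ p.2) (z : Fin 3 → ℝ)
    (s : Finset (ℕ × Set E3)) (hs : ∀ p ∈ s, p ∈ 𝕋 ∧ p.1 = k)
    (hz : ∀ p ∈ s, ∀ i, |frenetCoord (leftEnd R k) (fun j => cen p j) i - z i| ≤ 2 * D i) :
    (s.card : ℝ) ≤ A * (2 * (A * (A + 2)) + 2) ^ 3 * N := by
  classical
  have hA0 : 0 < A := by linarith
  obtain ⟨F, ⟨hbox, hover, -⟩, hin, hN⟩ := hS k hk
  have hsel : ∀ p : ℕ × Set E3, ∃ S : Set E3, p ∈ s → S ∈ F ∧ p.2 ⊆ S := by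
    intro p
    by_cases hp : p ∈ s
    · obtain ⟨h1, h2⟩ := hs p hp
      obtain ⟨S, hSF, hpS⟩ := hin p.2 (by rw [tubesOf, Set.mem_ofPred_eq, ← h2]; exact h1)
      exact ⟨S, fun _ => ⟨hSF, hpS⟩⟩
    · exact ⟨∅, fun h => absurd h hp⟩
  choose sel hsel using hsel
  have hcent : ∀ S : Set E3, ∃ b : E3, S ∈ F →
      vinogradovBox (leftEnd R k) (A⁻¹ * D 0) (A⁻¹ * D 1) (A⁻¹ * D 2) b ⊆ S ∧
      S ⊆ vinogradovBox (leftEnd R k) (A * D 0) (A * D 1) (A * D 2) b := by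
    intro S
    by_cases h : S ∈ F
    · obtain ⟨b, hb⟩ := hbox S h
      exact ⟨b, fun _ => hb⟩
    · exact ⟨0, fun h' => absurd h' h⟩
  choose b hb using hcent
  have hGF : ∀ S ∈ s.image sel, S ∈ F := fun S hS' => by
    obtain ⟨p, hp, rfl⟩ := Finset.mem_image.1 hS'
    exact (hsel p hp).1
  -- `M = A + 2`: the tube centre is within `2 * D i` of `z`, and within `A * D i` of the centre of
  -- the box containing the tube.
  have hG := card_le_of_boundedOverlap (c := leftEnd R k) (M := A + 2) hA (by linarith) hD hover
    (s.image sel) hGF b (fun S hS' => (hb S (hGF S hS')).1) z fun S hS' i => by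
      obtain ⟨p, hp, rfl⟩ := Finset.mem_image.1 hS'
      have h1 := mem_vinogradovBox_iff.1 ((hb _ (hsel p hp).1).2
        ((hsel p hp).2 (hcen p (hs p hp).1)))
      have h2 : |frenetCoord (leftEnd R k) (fun j => cen p j - b (sel p) j) i| ≤ A * D i := by
        fin_cases i
        · exact h1.1
        · exact h1.2.1
        · exact h1.2.2
      have e := frenetCoord_sub (leftEnd R k) (fun j => cen p j) (fun j => b (sel p) j) i
      rw [show (fun j => cen p j - b (sel p) j) = (fun j => cen p j) - (fun j => b (sel p) j)
        from rfl, e] at h2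
      have h3 := hz p hp i
      rw [abs_le] at h2 h3 ⊢
      constructor <;> nlinarith [h2.1, h2.2, h3.1, h3.2]
  have hfib : ∀ S ∈ s.image sel, (s.filter fun p => sel p = S).card ≤ N := by
    intro S hS'
    refine le_trans ?_ (hN S (hGF S hS'))
    have hinj : Set.InjOn Prod.snd (s.filter fun p => sel p = S : Set (ℕ × Set E3)) := by
      intro p hp q hq h
      simp only [Finset.coe_filter, Set.mem_ofPred_eq] at hp hq
      exact Prod.ext ((hs p hp.1).2.trans (hs q hq.1).2.symm) h
    rw [← Finset.card_image_of_injOn hinj, ← Set.ncard_coe_finset]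
    refine Set.ncard_le_ncard (fun T hT => ?_) ?_
    · obtain ⟨p, hp, rfl⟩ := Finset.mem_image.1 (Finset.mem_coe.1 hT)
      rw [Finset.mem_filter] at hp
      obtain ⟨h1, h2⟩ := hs p hp.1
      refine ⟨by rw [tubesOf, Set.mem_ofPred_eq, ← h2]; exact h1, hp.2 ▸ (hsel p hp.1).2⟩
    · refine ((𝕋.image Prod.snd).finite_toSet).subset fun T hT => ?_
      exact Finset.mem_coe.2 (Finset.mem_image.2 ⟨(k, T), hT.1, rfl⟩)
  have h := Finset.card_le_mul_card_image s N hfib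
  calc (s.card : ℝ) ≤ N * ((s.image sel).card : ℝ) := by exact_mod_cast h
    _ ≤ N * (A * (2 * (A * (A + 2)) + 2) ^ 3) := by gcongr
    _ = _ := by ring

/-! ### Cubes, rescaling and the conclusion. -/

lemma ball_subset_cube {e : OrthonormalBasis (Fin 3) ℝ E3} {a : E3} {s : ℝ} :
    Metric.ball a (s / 2) ⊆ {x | ∀ i, |inner ℝ (e i) (x - a)| ≤ s / 2} := by
  intro x hx i
  rw [mem_ball_iff_norm] at hx
  refine (abs_real_inner_le_norm _ _).trans ?_
  rw [e.norm_eq_one, one_mul]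
  exact hx.le

/-- The half-diagonal `√3 * s / 2` is at most `s`, whatever the orientation. -/
lemma abs_sub_le_of_mem_cube {e : OrthonormalBasis (Fin 3) ℝ E3} {a x : E3} {s : ℝ}
    (hs : 0 ≤ s) (hx : ∀ i, |inner ℝ (e i) (x - a)| ≤ s / 2) (i : Fin 3) : |x i - a i| ≤ s := by
  have h1 : ‖x - a‖ ^ 2 ≤ s ^ 2 := by
    rw [← e.sum_sq_norm_inner_right, Fin.sum_univ_three]
    simp only [Real.norm_eq_abs]
    have h : ∀ i, |inner ℝ (e i) (x - a)| ^ 2 ≤ (s / 2) ^ 2 :=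
      fun i => pow_le_pow_left₀ (abs_nonneg _) (hx i) 2
    nlinarith [h 0, h 1, h 2]
  have h2 := abs_le_of_sq_le_sq h1 hs
  rw [abs_norm] at h2
  exact (PiLp.norm_apply_le (x - a) i).trans h2

/-- Cubes with disjoint interiors have separated centres. -/
lemma eq_of_centers_close {p q : Set E3} {a b : E3} {s t η : ℝ} (hη : 0 < η)
    (hs : 2 * η ≤ s / 2) (ht : 0 < t) (hp : Metric.ball a (s / 2) ⊆ p)
    (hq : Metric.ball b (t / 2) ⊆ q) (hab : ∀ i, |a i - b i| < η)
    (hdisj : p ≠ q → Disjoint (interior p) (interior q)) : p = q := by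
  by_contra hne
  have hb1 : b ∈ Metric.ball a (s / 2) := by
    rw [mem_ball_iff_norm, ← norm_neg, neg_sub]
    refine lt_of_lt_of_le ?_ hs
    have : ‖a - b‖ ^ 2 < (2 * η) ^ 2 := by
      rw [EuclideanSpace.norm_sq_eq, Fin.sum_univ_three]
      simp only [Real.norm_eq_abs, PiLp.sub_apply]
      have h : ∀ i, |a i - b i| ^ 2 ≤ η ^ 2 :=
        fun i => pow_le_pow_left₀ (abs_nonneg _) (hab i).le 2
      nlinarith [h 0, h 1, h 2, sq_pos_of_pos hη]
    exact lt_of_pow_lt_pow_left₀ 2 (by positivity) this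
  exact Set.disjoint_left.1 (hdisj hne) (interior_maximal hp Metric.isOpen_ball hb1)
    (interior_maximal hq Metric.isOpen_ball (Metric.mem_ball_self (by positivity)))

/-- The constant in the bound for the number of tubes in a plank. -/
def plankConst (A : ℝ) : ℝ := A * (2 * (A * (A + 2)) + 2) ^ 3

lemma rpow_facts {R : ℝ} (hR : 2 ≤ R) : 0 < R ^ (-(1 / 3) : ℝ) ∧ R ^ (-(1 / 3) : ℝ) ≤ 1 ∧
    0 < R ^ (2 / 3 : ℝ) ∧ R = R ^ (2 / 3 : ℝ) / R ^ (-(1 / 3) : ℝ) ∧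
    R ^ (1 / 3 : ℝ) = 1 / R ^ (-(1 / 3) : ℝ) ∧
    R ^ (1 / 6 : ℝ) * Real.sqrt (R ^ (-(1 / 3) : ℝ)) = 1 ∧
    R ^ (5 / 6 : ℝ) = R ^ (2 / 3 : ℝ) * R ^ (1 / 6 : ℝ) := by
  have h0 : 0 < R := by linarith
  refine ⟨by positivity, Real.rpow_le_one_of_one_le_of_nonpos (by linarith) (by norm_num),
    by positivity, ?_, ?_, ?_, ?_⟩
  · rw [← Real.rpow_sub h0]; norm_num
  · rw [Real.rpow_neg h0.le]; simp
  · rw [Real.sqrt_eq_rpow, ← Real.rpow_mul h0.le, ← Real.rpow_add h0]; norm_num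
  · rw [← Real.rpow_add h0]; norm_num

lemma dyadic_count_le_log {R : ℝ} (hR : 2 ≤ R) {J : ℕ} (hJ : (4 : ℝ) ^ J ≤ R ^ (1 / 3 : ℝ)) :
    ((J : ℝ) + 1) ^ 2 ≤ 9 * Real.log R ^ 2 := by
  have h0 : 0 < R := by linarith
  have hlog : Real.log 2 ≤ Real.log R := Real.log_le_log (by norm_num) hR
  have h2 := Real.log_two_gt_d9
  have h := Real.log_le_log (by positivity) hJ
  rw [Real.log_pow, Real.log_rpow h0, show (4 : ℝ) = 2 ^ 2 by norm_num, Real.log_pow] at h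
  push_cast at h
  have hJ0 : (0 : ℝ) ≤ J := Nat.cast_nonneg J
  have : (J : ℝ) + 1 ≤ 3 * Real.log R := by nlinarith
  nlinarith

/-- The rich cube estimate in terms of `d = R^{-1/3}`, with constants depending only on `A`. -/
lemma card_rich_cubes_le {A R r : ℝ} (hA : 1 ≤ A) (hR : 2 ≤ R) {𝕋 : Finset (ℕ × Set E3)} {N : ℕ}
    {Q : Finset (Set E3)} {J : ℕ} (hT : IsSeparatedTubeFamily A R 𝕋)
    (hS : SpacingCondition A R (R ^ (2 / 3 : ℝ)) (R ^ (5 / 6 : ℝ)) R 𝕋 N) (hr0 : 0 < r)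
    (hr : 8 * (plankConst A * N) * latticeMass ≤
      Real.exp (-Real.pi * (78 * A ^ 2)) * r * Real.sqrt (R ^ (-(1 / 3) : ℝ)))
    (hQ : IsRichCubeFamily A R 𝕋 r Q) (hJ : (4 : ℝ) ^ J ≤ 1 / R ^ (-(1 / 3) : ℝ))
    (hJ' : 1 / R ^ (-(1 / 3) : ℝ) < (4 : ℝ) ^ (J + 1)) :
    Real.exp (-Real.pi * (78 * A ^ 2)) ^ 2 * (r ^ 2 * R ^ (-(1 / 3) : ℝ) * Q.card) ≤
      576 * (98000 * (4 * A) ^ 6 * (latticeMass + 1)) * latticeMass *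
        ((J + 1) ^ 2 * (plankConst A * N) * 𝕋.card) := by
  classical
  have hA0 : 0 < A := by linarith
  have hR0 : 0 < R := by linarith
  obtain ⟨hd0, hd1, hρ0, hRd, -, h16, h56⟩ := rpow_facts hR
  have hle : ∀ k, leftEnd R k = k * R ^ (-(1 / 3) : ℝ) := fun k => rfl
  generalize hdef : R ^ (-(1 / 3) : ℝ) = d at *
  generalize hρdef : R ^ (2 / 3 : ℝ) = ρ at *
  have hρR : ρ ≤ R := by
    rw [hRd, le_div_iff₀ hd0]
    exact mul_le_of_le_one_right hρ0.le hd1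
  have hRdρ : R * d = ρ := by rw [hRd]; field_simp
  -- The number of intervals of the partition, that is, of `k` with `k * d < 1`.
  set n := ⌈1 / d⌉₊ with hn
  have hkn : ∀ k : ℕ, k < n ↔ (k : ℝ) * d < 1 := fun k => by
    rw [hn, Nat.lt_ceil, lt_div_iff₀ hd0]
  have hn2 : (n : ℝ) * d ≤ 2 := by
    have := Nat.ceil_lt_add_one (a := 1 / d) (by positivity)
    have h2 : (1 / d + 1) * d = 1 + d := by field_simp
    have h3 := mul_le_mul_of_nonneg_right this.le hd0.le
    linarith
  have hcen : ∀ p : ℕ × Set E3, ∃ a : E3, p ∈ 𝕋 → a ∈ p.2 ∧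
      p.2 ⊆ vinogradovBox (leftEnd R p.1) (A * ρ) (A * ρ) (A * R) a := by
    intro p
    by_cases hp : p ∈ 𝕋
    · have hbox := (hT.1 p hp).2.1
      rw [hρdef] at hbox
      obtain ⟨a, ha1, ha2⟩ := hbox
      exact ⟨a, fun _ => ⟨center_mem_of_isVinogradovBox (by positivity) (by positivity)
        (by positivity) ha1, ha2⟩⟩
    · exact ⟨0, fun h => absurd h hp⟩
  choose cen hcen using hcen
  have hcube : ∀ q : Set E3, ∃ (a : E3) (s : ℝ), q ∈ Q → A⁻¹ * ρ ≤ s ∧ s ≤ A * ρ ∧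
      Metric.ball a (s / 2) ⊆ q ∧ ∀ x ∈ q, ∀ i, |x i - a i| ≤ s := by
    intro q
    by_cases hq : q ∈ Q
    · obtain ⟨⟨s, hs1, hs2, e, a, hqe⟩, -⟩ := hQ.1 q hq
      rw [hρdef] at hs1 hs2
      refine ⟨a, s, fun _ => ⟨hs1, hs2, ?_, fun x hx => ?_⟩⟩
      · rw [hqe]; exact ball_subset_cube
      · rw [hqe] at hx
        exact abs_sub_le_of_mem_cube (le_trans (by positivity) hs1) hx
    · exact ⟨0, 0, fun h => absurd h hq⟩
  choose ctr side hcube using hcube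
  set T : ℕ → Finset (ℕ × Set E3) := fun k => 𝕋.filter fun p => p.1 = k with hTdef
  have hmaps : ∀ p ∈ 𝕋, p.1 ∈ Finset.range n := fun p hp => by
    rw [Finset.mem_range, hkn, ← hle]; exact (hT.1 p hp).1
  have hcard : ∑ k ∈ Finset.range n, ((T k).card : ℝ) = 𝕋.card := by
    rw [Finset.card_eq_sum_card_fiberwise (s := 𝕋) (t := Finset.range n) (f := Prod.fst) hmaps]
    push_cast
    rfl
  set a : ℕ × Set E3 → Fin 3 → ℝ := fun p i => cen p i / ρ with ha
  set x : Set E3 → Fin 3 → ℝ := fun q i => ctr q i / ρ with hx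
  -- The rescaled plank is slightly wider than `R^{1/6}`; this is the reason for the factor 2
  -- allowed in `card_tubes_in_box_le`.
  have hsqrt : Real.sqrt (2 / d) ≤ 2 * R ^ (1 / 6 : ℝ) := by
    refine Real.sqrt_le_iff.2 ⟨by positivity, ?_⟩
    have h1 : (R ^ (1 / 6 : ℝ)) ^ 2 * d = 1 := by
      have := congrArg (fun t => t ^ 2) h16
      simpa only [mul_pow, Real.sq_sqrt hd0.le, one_pow] using this
    rw [div_le_iff₀ hd0]
    nlinarith
  -- `L = 4 * A` since a cube contains a ball of radius at least `ρ / (2 * A)` about its centre. `κ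
  -- = 78 * A ^ 2` is `(7A)² + (5A)² + (2A)²`, from the three coordinate bounds for a tube meeting a
  -- cube.
  have key := card_rich_points_le T a Q x (d := d) (P := plankConst A * N) (L := 4 * A)
    (κ := 78 * A ^ 2) (r := r) (n := n) (J := J) hd0 hd1 hn2
    (fun k hk => ((hkn k).1 hk).le) hJ hJ' (by unfold plankConst; positivity) (by linarith) hr0
    ?_ ?_ ?_ hr
  · rwa [hcard] at key
  · intro k hk y
    refine card_tubes_in_box_le (D := ![ρ, R ^ (5 / 6 : ℝ), R]) hA (fun i => ?_)
      (by simpa using hS) (by rw [hle, ← hkn]; exact hk) cen (fun p hp => (hcen p hp).1)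
      (fun i => ρ * frenetCoord (k * d) y i) _ (fun p hp => ?_) (fun p hp i => ?_)
    · fin_cases i
      · exact hρ0
      · exact Real.rpow_pos_of_pos hR0 _
      · exact hR0
    · have := (Finset.mem_filter.1 hp).1
      exact Finset.mem_filter.1 this
    · have h := (Finset.mem_filter.1 hp).2
      have e : ∀ i, |frenetCoord (k * d) (fun j => cen p j) i - ρ * frenetCoord (k * d) y i| =
          ρ * |frenetCoord (k * d) (a p - y) i| := fun i => by
        rw [frenetCoord_sub, ha, frenetCoord_div]
        nth_rewrite 2 [← abs_of_pos hρ0]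
        rw [← abs_mul]
        congr 1
        field_simp
      rw [hle, e]
      fin_cases i
      · simpa using (mul_le_mul_of_nonneg_left h.1 hρ0.le).trans (by linarith : ρ * 1 ≤ 2 * ρ)
      · refine (mul_le_mul_of_nonneg_left (h.2.1.trans hsqrt) hρ0.le).trans (le_of_eq ?_)
        simp only [Fin.mk_one, Matrix.cons_val_one, Matrix.cons_val_zero, h56]
        ring
      · refine (mul_le_mul_of_nonneg_left h.2.2 hρ0.le).trans ?_
        rw [mul_one_div, ← hRd]
        simp only [Fin.reduceFinMk, Matrix.cons_val]
        linarith
  · intro p hp q hq hpq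
    obtain ⟨hs1, -, hs3, -⟩ := hcube p hp
    obtain ⟨ht1, -, ht3, -⟩ := hcube q hq
    have hAρ : 0 < A⁻¹ * ρ := by positivity
    refine eq_of_centers_close (η := ρ / (4 * A)) (by positivity) ?_ (hAρ.trans_le ht1) hs3 ht3
      (fun i => ?_) fun hne => hQ.2 hp hq hne
    · have : 2 * (ρ / (4 * A)) = A⁻¹ * ρ / 2 := by field_simp; norm_num
      linarith
    · have := hpq i
      simp only [hx] at this
      rw [← sub_div, abs_div, abs_of_pos hρ0, div_lt_div_iff₀ hρ0 (by positivity), one_mul] at this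
      rwa [lt_div_iff₀ (by positivity)]
  · intro q hq
    obtain ⟨-, hs2, -, hs4⟩ := hcube q hq
    have hrich := (hQ.1 q hq).2
    have hset : {p | p ∈ 𝕋 ∧ (p.2 ∩ q).Nonempty} =
        ((𝕋.filter fun p => (p.2 ∩ q).Nonempty : Finset (ℕ × Set E3)) : Set (ℕ × Set E3)) := by
      ext p; simp
    rw [IsRich, hset, Set.ncard_coe_finset, Finset.card_eq_sum_card_fiberwise
      (t := Finset.range n) (f := Prod.fst)
      (fun p hp => hmaps p (Finset.mem_filter.1 hp).1)] at hrich
    refine hrich.trans ?_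
    push_cast
    refine Finset.sum_le_sum fun k hk => Nat.cast_le.2 (Finset.card_le_card fun p hp => ?_)
    rw [Finset.mem_range, hkn] at hk
    simp only [Finset.mem_filter] at hp
    obtain ⟨⟨hpT, z, hzp, hzq⟩, rfl⟩ := hp
    simp only [hTdef, Finset.mem_filter]
    refine ⟨⟨hpT, trivial⟩, ?_⟩
    have hbox := mem_vinogradovBox_iff.1 ((hcen p hpT).2 hzp)
    rw [hle] at hbox
    have hzc : ∀ i, |z i - ctr q i| ≤ A * ρ := fun i => (hs4 z hzq i).trans hs2
    set c : ℝ := (p.1 : ℝ) * d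
    have hc0 : 0 ≤ c := by positivity
    have hfc : ∀ i, frenetCoord c (x q - a p) i =
        (frenetCoord c (fun j => z j - cen p j) i -
          frenetCoord c (fun j => z j - ctr q j) i) / ρ := fun i => by
      rw [show x q - a p = fun j => ((fun j => z j - cen p j) - (fun j => z j - ctr q j)) j / ρ by
        funext j; simp only [hx, ha, Pi.sub_apply]; ring, frenetCoord_div, frenetCoord_sub]
    have hz0 := abs_le.1 (hzc 0)
    have hz1 := abs_le.1 (hzc 1)
    have hz2 := abs_le.1 (hzc 2)
    have hb0 := abs_le.1 hbox.1
    have hb1 := abs_le.1 hbox.2.1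
    have hb2 := abs_le.1 hbox.2.2
    have hc2 : c ^ 2 ≤ 1 := by nlinarith
    have g1 : |c * (z 1 - ctr q 1)| ≤ A * ρ := by
      rw [abs_mul, abs_of_nonneg hc0]
      exact (mul_le_of_le_one_left (abs_nonneg _) hk.le).trans (hzc 1)
    have g2 : |c * (z 2 - ctr q 2)| ≤ A * ρ := by
      rw [abs_mul, abs_of_nonneg hc0]
      exact (mul_le_of_le_one_left (abs_nonneg _) hk.le).trans (hzc 2)
    have g3 : |c ^ 2 * (z 2 - ctr q 2)| ≤ A * ρ := by
      rw [abs_mul, abs_of_nonneg (sq_nonneg c)]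
      exact (mul_le_of_le_one_left (abs_nonneg _) hc2).trans (hzc 2)
    rw [abs_le] at g1 g2 g3
    -- `7 = 1 + (1 + 2 + 3)`: the tube, then the cube with the coefficients `1, 2c, 3c²`. The next
    -- two bounds use `1 + (1 + 3)` and `1 + 1`.
    have f0 : |frenetCoord c (x q - a p) 0| ≤ 7 * A := by
      rw [hfc, abs_div, abs_of_pos hρ0, div_le_iff₀ hρ0, abs_le]
      have : frenetCoord c (fun j => z j - ctr q j) 0 = (z 0 - ctr q 0) +
        2 * (c * (z 1 - ctr q 1)) + 3 * (c ^ 2 * (z 2 - ctr q 2)) := by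
          simp only [frenetCoord, Matrix.cons_val_zero]; ring
      rw [this]
      constructor <;> linarith [g1.1, g1.2, g3.1, g3.2]
    have f1 : |frenetCoord c (x q - a p) 1| ≤ 5 * A := by
      rw [hfc, abs_div, abs_of_pos hρ0, div_le_iff₀ hρ0, abs_le]
      have : frenetCoord c (fun j => z j - ctr q j) 1 = (z 1 - ctr q 1) +
        3 * (c * (z 2 - ctr q 2)) := by
          simp only [frenetCoord, Matrix.cons_val_one, Matrix.cons_val_zero]; ring
      rw [this]
      constructor <;> linarith [g2.1, g2.2]
    have f2 : |frenetCoord c (x q - a p) 2 * d| ≤ 2 * A := by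
      have hAR : A * ρ ≤ A * R := by gcongr
      rw [hfc, ← mul_div_right_comm, abs_div, abs_of_pos hρ0, div_le_iff₀ hρ0, abs_mul,
        abs_of_pos hd0, ← hRdρ, ← mul_assoc]
      refine mul_le_mul_of_nonneg_right (abs_le.2 ?_) hd0.le
      have : frenetCoord c (fun j => z j - ctr q j) 2 = z 2 - ctr q 2 := rfl
      rw [this]
      constructor <;> linarith
    rw [Fin.sum_univ_three]
    simp only [boxCoeff, Matrix.cons_val_zero, Matrix.cons_val_one, Matrix.cons_val, div_inv_eq_mul,
      ← mul_pow, add_zero, div_one]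
    have s0 := sq_le_sq' (abs_le.1 f0).1 (abs_le.1 f0).2
    have s1 := sq_le_sq' (abs_le.1 f1).1 (abs_le.1 f1).2
    have s2 := sq_le_sq' (abs_le.1 f2).1 (abs_le.1 f2).2
    linarith

theorem mainTheorem11 (A : ℝ) (hA : 1 ≤ A) :
    ∃ (C : ℝ) (κ : ℕ), ∀ ε : ℝ, 0 < ε → ∃ Cε : ℝ, 0 < Cε ∧
      ∀ (R : ℝ) (𝕋 : Finset (ℕ × Set E3)) (N N₁ : ℕ) (r : ℝ) (Q : Finset (Set E3)),
        2 ≤ R →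
        IsSeparatedTubeFamily A R 𝕋 →
        SpacingCondition A R (R ^ (2 / 3 : ℝ)) R R 𝕋 N →
        SpacingCondition A R (R ^ (2 / 3 : ℝ)) (R ^ (5 / 6 : ℝ)) R 𝕋 N₁ →
        N₁ ≤ N →
        1 ≤ r →
        Cε * R ^ ε * N₁ * R ^ (1 / 6 : ℝ) ≤ r →
        IsRichCubeFamily A R 𝕋 r Q →
        (Q.card : ℝ) ≤
          C * Real.log R ^ κ * ((𝕋.card : ℝ) * N₁ * R ^ (1 / 3 : ℝ) / r ^ 2) := by
  have hM := latticeMass_nonneg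
  have hK : 0 < plankConst A := by unfold plankConst; positivity
  set e := Real.exp (-Real.pi * (78 * A ^ 2)) with he
  have he0 : 0 < e := Real.exp_pos _
  set B := 576 * (98000 * (4 * A) ^ 6 * (latticeMass + 1)) * latticeMass with hB
  have hB0 : 0 ≤ B := by positivity
  -- The power 2 of the logarithm is that of `(J + 1) ^ 2 ≤ 9 * log² R`. The threshold constant is
  -- the one that controls the low part; it is independent of `ε`, as `R ^ ε ≥ 1`.
  refine ⟨9 * B * plankConst A / e ^ 2, 2, fun ε hε =>
    ⟨8 * plankConst A * (latticeMass + 1) / e, by positivity, ?_⟩⟩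
  intro R 𝕋 N N₁ r Q hR hT _ hS _ hr1 hr hQ
  have hr0 : 0 < r := by linarith
  obtain ⟨hd0, hd1, -, -, h13, h16, -⟩ := rpow_facts hR
  obtain ⟨J, hJ, hJ'⟩ := exists_nat_pow_near (x := 1 / R ^ (-(1 / 3) : ℝ)) (y := 4)
    (by rw [le_div_iff₀ hd0]; linarith) (by norm_num)
  have hlog := dyadic_count_le_log hR (h13 ▸ hJ)
  have hRε : 1 ≤ R ^ ε := Real.one_le_rpow (by linarith) hε.le
  have hsq0 := Real.sqrt_nonneg (R ^ (-(1 / 3) : ℝ))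
  have hlow : 8 * (plankConst A * N₁) * latticeMass ≤
      e * r * Real.sqrt (R ^ (-(1 / 3) : ℝ)) := by
    have h1 := mul_le_mul_of_nonneg_right hr hsq0
    rw [mul_assoc, h16, mul_one] at h1
    have h2 : 8 * plankConst A * (latticeMass + 1) / e * 1 * N₁ ≤
        8 * plankConst A * (latticeMass + 1) / e * R ^ ε * N₁ := by gcongr
    have h3 := mul_le_mul_of_nonneg_left (h2.trans h1) he0.le
    have h4 : e * (8 * plankConst A * (latticeMass + 1) / e * 1 * N₁) =
        8 * (plankConst A * N₁) * (latticeMass + 1) := by field_simp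
    have h5 : 8 * (plankConst A * N₁) * latticeMass ≤
        8 * (plankConst A * N₁) * (latticeMass + 1) := by gcongr; linarith
    linarith
  have h := card_rich_cubes_le hA hR hT hS hr0 hlow hQ hJ hJ'
  rw [h13]
  generalize R ^ (-(1 / 3) : ℝ) = d at *
  have h2 : e ^ 2 * (r ^ 2 * d * Q.card) ≤
      B * (9 * Real.log R ^ 2 * (plankConst A * N₁) * 𝕋.card) := by
    refine h.trans ?_
    gcongr
  have h3 : 9 * B * plankConst A / e ^ 2 * Real.log R ^ 2 * ((𝕋.card : ℝ) * N₁ * (1 / d) / r ^ 2) =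
      B * (9 * Real.log R ^ 2 * (plankConst A * N₁) * 𝕋.card) / (e ^ 2 * (r ^ 2 * d)) := by
    field_simp
  rw [h3, le_div_iff₀ (by positivity)]
  linarith

end
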